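/- Let $p,d\in C^1([0,\infty),\mathbb R)$, $b,c\in C^1([0,\infty),\mathbb C)$ and $q\in C([0,\infty),\mathbb R)$ with $p(x)>0$ for all $x\in[0,\infty)$. In the Hilbert space $L^2(0,\infty)^2=L^2(0,\infty)\oplus L^2(0,\infty)$ of complex-valued functions consider the operator $$\mathcal A_0\binom{f_1}{f_2}=\binom{-(pf_1')'+qf_1-(\overline b f_2)'+\overline c f_2}{b f_1'+c f_1+d f_2},\qquad \mathcal D(\mathcal A_0)=C_0^2((0,\infty))\oplus C_0^1((0,\infty)),$$ where $C_0^k((0,\infty))$ is the space of $k$ times continuously differentiable functions $(0,\infty)\to\mathbb C$ with compact support contained in $(0,\infty)$. Then $\mathcal A_0$ is densely defined and symmetric. Its adjoint $\mathcal A_0^*$ has the domain $$\mathcal D(\mathcal A_0^*)=\Bigl\{\tbinom{y_1}{y_2}\in L^2(0,\infty)^2:\ y_1,\ py_1'+\overline b y_2\in \mathrm{AC}_{\rm loc}([0,\infty)),\ -(py_1'+\overline b y_2)'+qy_1+\overline c y_2\in L^2(0,\infty),\ by_1'+cy_1+dy_2\in L^2(0,\infty)\Bigr\}$$ and acts by $$\mathcal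 A_0^*\binom{y_1}{y_2}=\binom{-(py_1'+\overline b y_2)'+qy_1+\overline c y_2}{by_1'+cy_1+dy_2}.$$ Here $\mathrm{AC}_{\rm loc}([0,\infty))$ is the space of functions that are absolutely continuous on every compact subinterval of $[0,\infty)$, and membership of an almost-everywhere class means that it has a representative in this space. Moreover, $\dim\ker(\mathcal A_0^*-\lambda)\le 2$ for all $\lambda\in\mathbb C\setminus\mathbb R$. -/

import Mathlib

open MeasureTheory Set

open scoped ComplexConjugate LinearPMap

namespace SingularSystem

/-- Lebesgue measure on the half-line `(0, ∞)`. -/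
noncomputable abbrev halfLine : Measure ℝ := volume.restrict (Ioi (0 : ℝ))

/-- The Hilbert space `L²(0, ∞)` of complex-valued functions. -/
abbrev L2 : Type := Lp ℂ 2 halfLine

/-- The Hilbert space `L²(0, ∞) ⊕ L²(0, ∞)`; the components of `y` are `y.fst` and `y.snd`. -/
abbrev L2Sq : Type := WithLp 2 (L2 × L2)

/-- Hypotheses on the coefficients: `p`, `d` are real and `b` is complex, all in `C¹([0, ∞))`,
`c ∈ C¹([0, ∞), ℂ)`, `q ∈ C([0, ∞), ℝ)`, and `p > 0` on `[0, ∞)`. The values of the coefficients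
on the negative half-line play no role. -/
structure CoeffHyp (p q d : ℝ → ℝ) (b c : ℝ → ℂ) : Prop where
  p_contDiffOn : ContDiffOn ℝ 1 p (Ici 0)
  d_contDiffOn : ContDiffOn ℝ 1 d (Ici 0)
  b_contDiffOn : ContDiffOn ℝ 1 b (Ici 0)
  c_contDiffOn : ContDiffOn ℝ 1 c (Ici 0)
  q_continuousOn : ContinuousOn q (Ici 0)
  p_pos : ∀ x ∈ Ici (0 : ℝ), 0 < p x

/-- `C₀ᵏ((0, ∞))`: the `k` times continuously differentiable complex functions with compact
support contained in `(0, ∞)` (extended by zero to `ℝ`). -/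
def testSpace (k : ℕ) : Submodule ℂ (ℝ → ℂ) where
  carrier := {f | ContDiff ℝ k f ∧ HasCompactSupport f ∧ tsupport f ⊆ Ioi 0}
  zero_mem' := by
    refine ⟨contDiff_const, HasCompactSupport.zero, ?_⟩
    simp [tsupport]
  add_mem' := by
    rintro f g ⟨hf, hf', hf''⟩ ⟨hg, hg', hg''⟩
    exact ⟨hf.add hg, hf'.add hg', (tsupport_add f g).trans (union_subset hf'' hg'')⟩
  smul_mem' := by
    rintro a f ⟨hf, hf', hf''⟩
    refine ⟨contDiff_const.smul hf, hf'.smul_left (f := fun _ => a), ?_⟩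
    exact (tsupport_smul_subset_right (fun _ => a) f).trans hf''

/-- First row of the differential expression:
`-(p f₁')' + q f₁ - (b̄ f₂)' + c̄ f₂`. -/
noncomputable def row1 (p q : ℝ → ℝ) (b c : ℝ → ℂ) (f₁ f₂ : ℝ → ℂ) : ℝ → ℂ := fun x =>
  -deriv (fun t => (p t : ℂ) * deriv f₁ t) x + (q x : ℂ) * f₁ x
    - deriv (fun t => conj (b t) * f₂ t) x + conj (c x) * f₂ x

/-- Second row of the differential expression: `b f₁' + c f₁ + d f₂`. -/
noncomputable def row2 (d : ℝ → ℝ) (b c : ℝ → ℂ) (f₁ f₂ : ℝ → ℂ) : ℝ → ℂ := fun x =>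
  b x * deriv f₁ x + c x * f₁ x + (d x : ℂ) * f₂ x

section Regularity

theorem memLp_of_testSpace {k : ℕ} {f g : ℝ → ℂ} (hf : f ∈ testSpace k)
    (hg : ContinuousOn g (Ioi 0)) (hs : Function.support g ⊆ tsupport f) :
    MemLp g 2 halfLine := by
  obtain ⟨-, hf2, hf3⟩ := hf
  have hts : tsupport g ⊆ tsupport f := closure_minimal hs (isClosed_tsupport f)
  have hc : Continuous g := continuous_of_tsupport fun x hx =>
    hg.continuousAt (Ioi_mem_nhds (hf3 (hts hx)))
  exact hc.memLp_of_hasCompactSupport (hf2.mono' hs)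

theorem contDiffOn_deriv {n : ℕ} {g : ℝ → ℂ} (hg : ContDiffOn ℝ (n + 1 : ℕ) g (Ioi 0)) :
    ContDiffOn ℝ n (deriv g) (Ioi 0) :=
  hg.deriv_of_isOpen isOpen_Ioi (by norm_cast)

theorem support_mul_deriv_subset (a f : ℝ → ℂ) :
    Function.support (fun t => a t * deriv f t) ⊆ tsupport f :=
  (Function.support_mul_subset_right _ _).trans support_deriv_subset

theorem support_deriv_mul_subset (a f : ℝ → ℂ) :
    Function.support (deriv fun t => a t * f t) ⊆ tsupport f :=
  support_deriv_subset.trans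
    (closure_mono (Function.support_mul_subset_right a f))

theorem support_deriv_mul_deriv_subset (a f : ℝ → ℂ) :
    Function.support (deriv fun t => a t * deriv f t) ⊆ tsupport f :=
  support_deriv_subset.trans
    (closure_minimal (support_mul_deriv_subset a f) (isClosed_tsupport f))

variable {p q d : ℝ → ℝ} {b c : ℝ → ℂ} {f₁ f₂ : ℝ → ℂ}

theorem CoeffHyp.contDiffOn_p (h : CoeffHyp p q d b c) :
    ContDiffOn ℝ 1 (fun t => (p t : ℂ)) (Ioi 0) :=
  Complex.ofRealCLM.contDiff.comp_contDiffOn (h.p_contDiffOn.mono Ioi_subset_Ici_self)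

theorem CoeffHyp.contDiffOn_conj_b (h : CoeffHyp p q d b c) :
    ContDiffOn ℝ 1 (fun t => conj (b t)) (Ioi 0) :=
  Complex.conjCLE.contDiff.comp_contDiffOn (h.b_contDiffOn.mono Ioi_subset_Ici_self)

theorem CoeffHyp.contDiffOn_flux1 (h : CoeffHyp p q d b c) (h₁ : f₁ ∈ testSpace 2) :
    ContDiffOn ℝ 1 (fun t => (p t : ℂ) * deriv f₁ t) (Ioi 0) :=
  h.contDiffOn_p.mul (contDiffOn_deriv (n := 1) h₁.1.contDiffOn)

theorem CoeffHyp.contDiffOn_flux2 (h : CoeffHyp p q d b c) (h₂ : f₂ ∈ testSpace 1) :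
    ContDiffOn ℝ 1 (fun t => conj (b t) * f₂ t) (Ioi 0) :=
  h.contDiffOn_conj_b.mul h₂.1.contDiffOn

theorem CoeffHyp.memLp_row1 (h : CoeffHyp p q d b c)
    (h₁ : f₁ ∈ testSpace 2) (h₂ : f₂ ∈ testSpace 1) :
    MemLp (row1 p q b c f₁ f₂) 2 halfLine := by
  have e1 : MemLp (deriv fun t => (p t : ℂ) * deriv f₁ t) 2 halfLine :=
    memLp_of_testSpace h₁ (contDiffOn_deriv (n := 0) (h.contDiffOn_flux1 h₁)).continuousOn
      (support_deriv_mul_deriv_subset _ _)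
  have e2 : MemLp (fun x => (q x : ℂ) * f₁ x) 2 halfLine :=
    memLp_of_testSpace h₁
      ((Complex.continuous_ofReal.comp_continuousOn
        (h.q_continuousOn.mono Ioi_subset_Ici_self)).mul h₁.1.continuous.continuousOn)
      ((Function.support_mul_subset_right _ _).trans (subset_tsupport _))
  have e3 : MemLp (deriv fun t => conj (b t) * f₂ t) 2 halfLine :=
    memLp_of_testSpace h₂ (contDiffOn_deriv (n := 0) (h.contDiffOn_flux2 h₂)).continuousOn
      (support_deriv_mul_subset _ _)
  have e4 : MemLp (fun x => conj (c x) * f₂ x) 2 halfLine :=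
    memLp_of_testSpace h₂
      ((Complex.continuous_conj.comp_continuousOn
        (h.c_contDiffOn.continuousOn.mono Ioi_subset_Ici_self)).mul h₂.1.continuous.continuousOn)
      ((Function.support_mul_subset_right _ _).trans (subset_tsupport _))
  exact ((e1.neg.add e2).sub e3).add e4

theorem CoeffHyp.memLp_row2 (h : CoeffHyp p q d b c)
    (h₁ : f₁ ∈ testSpace 2) (h₂ : f₂ ∈ testSpace 1) :
    MemLp (row2 d b c f₁ f₂) 2 halfLine := by
  have e1 : MemLp (fun x => b x * deriv f₁ x) 2 halfLine :=
    memLp_of_testSpace h₁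
      ((h.b_contDiffOn.continuousOn.mono Ioi_subset_Ici_self).mul
        (contDiffOn_deriv (n := 1) h₁.1.contDiffOn).continuousOn)
      (support_mul_deriv_subset _ _)
  have e2 : MemLp (fun x => c x * f₁ x) 2 halfLine :=
    memLp_of_testSpace h₁
      ((h.c_contDiffOn.continuousOn.mono Ioi_subset_Ici_self).mul h₁.1.continuous.continuousOn)
      ((Function.support_mul_subset_right _ _).trans (subset_tsupport _))
  have e3 : MemLp (fun x => (d x : ℂ) * f₂ x) 2 halfLine :=
    memLp_of_testSpace h₂
      ((Complex.continuous_ofReal.comp_continuousOn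
        (h.d_contDiffOn.continuousOn.mono Ioi_subset_Ici_self)).mul h₂.1.continuous.continuousOn)
      ((Function.support_mul_subset_right _ _).trans (subset_tsupport _))
  exact (e1.add e2).add e3

theorem memLp_testSpace {k : ℕ} {f : ℝ → ℂ} (hf : f ∈ testSpace k) : MemLp f 2 halfLine :=
  memLp_of_testSpace hf hf.1.continuous.continuousOn (subset_tsupport _)

theorem eq_of_ae_eq_testSpace {k : ℕ} {f g : ℝ → ℂ} (hf : f ∈ testSpace k) (hg : g ∈ testSpace k)
    (hfg : f =ᵐ[halfLine] g) : f = g := by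
  have h := Measure.eqOn_open_of_ae_eq hfg isOpen_Ioi hf.1.continuous.continuousOn
    hg.1.continuous.continuousOn
  funext x
  by_cases hx : x ∈ Ioi (0 : ℝ)
  · exact h hx
  · rw [image_eq_zero_of_notMem_tsupport fun hh => hx (hf.2.2 hh),
      image_eq_zero_of_notMem_tsupport fun hh => hx (hg.2.2 hh)]

end Regularity

/-- The embedding of `C₀²((0, ∞)) ⊕ C₀¹((0, ∞))` into `L²(0, ∞)²`. -/
noncomputable def embed : (testSpace 2 × testSpace 1) →ₗ[ℂ] L2Sq where
  toFun f := WithLp.toLp 2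
    ((memLp_testSpace f.1.2).toLp f.1.1, (memLp_testSpace f.2.2).toLp f.2.1)
  map_add' _ _ := rfl
  map_smul' _ _ := rfl

theorem embed_injective : Function.Injective embed := by
  intro f g hfg
  have h := congrArg WithLp.ofLp hfg
  have h1 : (memLp_testSpace f.1.2).toLp f.1.1 = (memLp_testSpace g.1.2).toLp g.1.1 :=
    congrArg Prod.fst h
  have h2 : (memLp_testSpace f.2.2).toLp f.2.1 = (memLp_testSpace g.2.2).toLp g.2.1 :=
    congrArg Prod.snd h
  refine Prod.ext (Subtype.ext ?_) (Subtype.ext ?_)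
  · exact eq_of_ae_eq_testSpace f.1.2 g.1.2 ((MemLp.toLp_eq_toLp_iff _ _).1 h1)
  · exact eq_of_ae_eq_testSpace f.2.2 g.2.2 ((MemLp.toLp_eq_toLp_iff _ _).1 h2)

/-- The action `(f₁, f₂) ↦ (row1 f₁ f₂, row2 f₁ f₂)` on `C₀²((0, ∞)) ⊕ C₀¹((0, ∞))`, with values
in `L²(0, ∞)²`. -/
noncomputable def action {p q d : ℝ → ℝ} {b c : ℝ → ℂ} (h : CoeffHyp p q d b c) :
    (testSpace 2 × testSpace 1) →ₗ[ℂ] L2Sq where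
  toFun f := WithLp.toLp 2
    ((h.memLp_row1 f.1.2 f.2.2).toLp (row1 p q b c f.1.1 f.2.1),
      (h.memLp_row2 f.1.2 f.2.2).toLp (row2 d b c f.1.1 f.2.1))
  map_add' f g := by
    refine congrArg (WithLp.toLp 2) (Prod.ext ?_ ?_)
    · refine Eq.trans ?_
        (MemLp.toLp_add (h.memLp_row1 f.1.2 f.2.2) (h.memLp_row1 g.1.2 g.2.2))
      refine MemLp.toLp_congr (h.memLp_row1 (f + g).1.2 (f + g).2.2) _ (ae_restrict_of_forall_mem measurableSet_Ioi fun x hx => ?_)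
      have hx' := Ioi_mem_nhds (mem_Ioi.1 hx)
      have d1 {u : ℝ → ℂ} (hu : u ∈ testSpace 2) : Differentiable ℝ u :=
        hu.1.differentiable (by norm_num)
      have c1 {u : ℝ → ℂ} (hu : u ∈ testSpace 2) :=
        ((h.contDiffOn_flux1 hu).differentiableOn one_ne_zero).differentiableAt hx'
      have c2 {u : ℝ → ℂ} (hu : u ∈ testSpace 1) :=
        ((h.contDiffOn_flux2 hu).differentiableOn one_ne_zero).differentiableAt hx'
      have E1 : deriv (fun t => (p t : ℂ) * deriv (f.1.1 + g.1.1) t) x =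
          deriv (fun t => (p t : ℂ) * deriv f.1.1 t) x +
            deriv (fun t => (p t : ℂ) * deriv g.1.1 t) x := by
        rw [← deriv_fun_add (c1 f.1.2) (c1 g.1.2)]
        congr 1
        funext t
        rw [deriv_add (d1 f.1.2 t) (d1 g.1.2 t), mul_add]
      have E2 : deriv (fun t => conj (b t) * (f.2.1 + g.2.1) t) x =
          deriv (fun t => conj (b t) * f.2.1 t) x + deriv (fun t => conj (b t) * g.2.1 t) x := by
        rw [← deriv_fun_add (c2 f.2.2) (c2 g.2.2)]
        congr 1
        funext t
        rw [Pi.add_apply, mul_add]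
      simp only [row1, Prod.fst_add, Prod.snd_add, Submodule.coe_add, Pi.add_apply] at E1 E2 ⊢
      rw [E1, E2]
      ring
    · refine Eq.trans ?_
        (MemLp.toLp_add (h.memLp_row2 f.1.2 f.2.2) (h.memLp_row2 g.1.2 g.2.2))
      refine MemLp.toLp_congr (h.memLp_row2 (f + g).1.2 (f + g).2.2) _ (ae_of_all _ fun x => ?_)
      have d1 {u : ℝ → ℂ} (hu : u ∈ testSpace 2) : Differentiable ℝ u :=
        hu.1.differentiable (by norm_num)
      simp only [row2, Prod.fst_add, Prod.snd_add, Submodule.coe_add, Pi.add_apply]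
      rw [deriv_add (d1 f.1.2 x) (d1 g.1.2 x)]
      ring
  map_smul' a f := by
    refine congrArg (WithLp.toLp 2) (Prod.ext ?_ ?_)
    · refine Eq.trans ?_ (MemLp.toLp_const_smul a (h.memLp_row1 f.1.2 f.2.2))
      refine MemLp.toLp_congr (h.memLp_row1 (a • f).1.2 (a • f).2.2) _ (ae_of_all _ fun x => ?_)
      have E1 : deriv (fun t => (p t : ℂ) * deriv (a • f.1.1) t) x =
          a * deriv (fun t => (p t : ℂ) * deriv f.1.1 t) x := by
        rw [← deriv_const_mul_field]
        congr 1
        funext t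
        rw [deriv_const_smul_field, smul_eq_mul]
        ring
      have E2 : deriv (fun t => conj (b t) * (a • f.2.1) t) x =
          a * deriv (fun t => conj (b t) * f.2.1 t) x := by
        rw [← deriv_const_mul_field]
        congr 1
        funext t
        rw [Pi.smul_apply, smul_eq_mul]
        ring
      simp only [row1, Prod.smul_fst, Prod.smul_snd, Submodule.coe_smul, Pi.smul_apply,
        smul_eq_mul] at E1 E2 ⊢
      rw [E1, E2]
      ring
    · refine Eq.trans ?_ (MemLp.toLp_const_smul a (h.memLp_row2 f.1.2 f.2.2))
      refine MemLp.toLp_congr (h.memLp_row2 (a • f).1.2 (a • f).2.2) _ (ae_of_all _ fun x => ?_)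
      simp only [row2, Prod.smul_fst, Prod.smul_snd, Submodule.coe_smul, Pi.smul_apply,
        smul_eq_mul, deriv_const_smul_field]
      ring

/-- The matrix differential operator `𝒜₀` in `L²(0, ∞)²`: its domain is (the image of)
`C₀²((0, ∞)) ⊕ C₀¹((0, ∞))` and it acts by the differential expressions `row1`, `row2`. -/
noncomputable def opA0 {p q d : ℝ → ℝ} {b c : ℝ → ℂ} (h : CoeffHyp p q d b c) :
    L2Sq →ₗ.[ℂ] L2Sq where
  domain := LinearMap.range embed
  toFun := (action h).comp (LinearEquiv.ofInjective embed embed_injective).symm.toLinearMap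

/-- The defining property of `opA0`: it sends the class of `(f₁, f₂)` to that of
`(row1 f₁ f₂, row2 f₁ f₂)`. -/
theorem opA0_apply {p q d : ℝ → ℝ} {b c : ℝ → ℂ} (h : CoeffHyp p q d b c)
    (f : testSpace 2 × testSpace 1) :
    opA0 h ⟨embed f, LinearMap.mem_range_self embed f⟩ = action h f :=
  congrArg (action h) ((LinearEquiv.ofInjective embed embed_injective).symm_apply_apply f)

/-- `u ∈ AC_loc([0, ∞))`: `u` is absolutely continuous on every compact interval
`[s, t] ⊆ [0, ∞)`. -/
def ACLoc (u : ℝ → ℂ) : Prop :=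
  ∀ s t : ℝ, 0 ≤ s → 0 ≤ t → AbsolutelyContinuousOnInterval u s t

/-- `u` and `v` are locally absolutely continuous representatives on `[0, ∞)` of `y₁` and of
`p y₁' + b̄ y₂`, respectively. -/
structure IsACRep (p : ℝ → ℝ) (b : ℝ → ℂ) (y : L2Sq) (u v : ℝ → ℂ) : Prop where
  u_ac : ACLoc u
  v_ac : ACLoc v
  u_eq : u =ᵐ[halfLine] y.fst
  v_eq : v =ᵐ[halfLine] fun x => (p x : ℂ) * deriv u x + conj (b x) * y.snd x

/-- `-(p y₁' + b̄ y₂)' + q y₁ + c̄ y₂`, where `u` stands for `y₁` and `v` for `p y₁' + b̄ y₂`. -/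
noncomputable def maxRow1 (q : ℝ → ℝ) (c : ℝ → ℂ) (u v y₂ : ℝ → ℂ) : ℝ → ℂ := fun x =>
  -deriv v x + (q x : ℂ) * u x + conj (c x) * y₂ x

end SingularSystem

/-! Only the combination `v = p y₁' + b̄ y₂` is regular, not `y₂` by itself; everything is therefore
phrased with absolutely continuous representatives `u` of `y₁` and `v` of this flux. For such `u`,
`v`, integration by parts against test functions leaves no boundary terms. The resulting Green
formula (`IsACRep.inner_action`) gives the symmetry of `𝒜₀` and one inclusion for the domain of the
adjoint.

For the other inclusion, let `w = 𝒜₀* y` and test with `(f, 0)` and `(0, f)` separately. The first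
choice yields, after integrating the lower order terms, a function `K` with `K - ȳ₁` orthogonal to
every `(p f')'`. A second order du Bois-Reymond lemma (`CoeffHyp.ae_eq_add_mul_integral_inv`)
identifies this difference as `α + β ∫ 1/p`, so `y₁` and the flux are absolutely continuous. The
second choice then gives the second row by the fundamental lemma.

For non-real `λ` the second row of `𝒜₀* y = λ y` is an algebraic equation for `y₂`, with coefficient
`p (λ - d) + |b|²` of imaginary part `p Im λ ≠ 0`. Eliminating `y₂` leaves a linear first order
system for `(u, v)` with continuous coefficients, so a solution is determined by `(u 0, v 0) ∈ ℂ²`.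
-/

namespace SingularSystem

/-! ### Local integrability on the half-line. -/

section LocallyIntegrable

theorem _root_.IntervalIntegrable.complexOfReal {f : ℝ → ℝ} {a b : ℝ}
    (hf : IntervalIntegrable f volume a b) :
    IntervalIntegrable (fun x => (f x : ℂ)) volume a b :=
  ⟨hf.1.ofReal, hf.2.ofReal⟩

theorem halfLine_eq_Ici : halfLine = volume.restrict (Ici (0 : ℝ)) :=
  Measure.restrict_congr_set Ioi_ae_eq_Ici

/-- Local integrability for `halfLine` quantifies over neighbourhoods of all real points, 0
included, so it controls a function up to the endpoint. -/
theorem locallyIntegrable_halfLine_iff {E : Type*} [NormedAddCommGroup E] {g : ℝ → E} :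
    LocallyIntegrable g halfLine ↔ LocallyIntegrableOn g (Ici 0) := by
  rw [locallyIntegrableOn_iff_locallyIntegrable_restrict isClosed_Ici, halfLine_eq_Ici]

theorem locallyIntegrable_of_continuousOn {E : Type*} [NormedAddCommGroup E] {g : ℝ → E}
    (hg : ContinuousOn g (Ici 0)) : LocallyIntegrable g halfLine :=
  locallyIntegrable_halfLine_iff.2 (hg.locallyIntegrableOn measurableSet_Ici)

theorem locallyIntegrable_continuousOn_mul {g a : ℝ → ℂ} (hg : LocallyIntegrable g halfLine)
    (ha : ContinuousOn a (Ici 0)) : LocallyIntegrable (fun x => a x * g x) halfLine :=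
  locallyIntegrable_halfLine_iff.2 <|
    (locallyIntegrable_halfLine_iff.1 hg).continuousOn_mul ha isClosed_Ici.isLocallyClosed

theorem intervalIntegrable_of_locallyIntegrable {E : Type*} [NormedAddCommGroup E] {g : ℝ → E}
    (hg : LocallyIntegrable g halfLine) {s t : ℝ} (hs : 0 ≤ s) (ht : 0 ≤ t) :
    IntervalIntegrable g volume s t := by
  rw [intervalIntegrable_iff']
  refine (locallyIntegrable_halfLine_iff.1 hg).integrableOn_compact_subset ?_ isCompact_uIcc
  exact fun x hx => (le_inf hs ht).trans hx.1

theorem locallyIntegrable_of_intervalIntegrable {E : Type*} [NormedAddCommGroup E] {g : ℝ → E}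
    (hg : ∀ t : ℝ, 0 ≤ t → IntervalIntegrable g volume 0 t) : LocallyIntegrable g halfLine := by
  rw [halfLine_eq_Ici, ← locallyIntegrableOn_iff_locallyIntegrable_restrict isClosed_Ici,
    locallyIntegrableOn_iff isClosed_Ici.isLocallyClosed]
  intro k hk hkc
  obtain ⟨R, hR⟩ := hkc.bddAbove
  refine ((intervalIntegrable_iff').1 (hg (max R 0) (le_max_right _ _))).mono_set fun x hx => ?_
  rw [uIcc_of_le (le_max_right _ _)]
  exact ⟨hk hx, (hR hx).trans (le_max_left _ _)⟩

theorem integrable_mul_of_hasCompactSupport {g f : ℝ → ℂ} (hg : LocallyIntegrable g halfLine)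
    (hf : Continuous f) (hf' : HasCompactSupport f) :
    Integrable (fun x => g x * f x) halfLine := by
  simpa using hg.integrable_smul_right_of_hasCompactSupport hf hf'

/-- An almost everywhere statement on the half-line can be checked on every `[0, n]`. -/
theorem ae_halfLine_of_forall_Icc {P : ℝ → Prop}
    (hP : ∀ t : ℝ, 0 ≤ t → ∀ᵐ x, x ∈ Icc 0 t → P x) : ∀ᵐ x ∂halfLine, P x := by
  rw [ae_restrict_iff' measurableSet_Ioi]
  filter_upwards [ae_all_iff.2 fun n : ℕ => hP n n.cast_nonneg] with x hx hx0
  obtain ⟨n, hn⟩ := exists_nat_ge x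
  exact hx n ⟨le_of_lt hx0, hn⟩

/-- Continuous functions on `[0, ∞)` agreeing almost everywhere agree. -/
theorem eqOn_Ici_of_ae_eq {u v : ℝ → ℂ} (hu : ContinuousOn u (Ici 0)) (hv : ContinuousOn v (Ici 0))
    (huv : u =ᵐ[halfLine] v) : EqOn u v (Ici 0) := by
  have h := Measure.eqOn_open_of_ae_eq huv isOpen_Ioi (hu.mono Ioi_subset_Ici_self)
    (hv.mono Ioi_subset_Ici_self)
  exact h.of_subset_closure hu hv Ioi_subset_Ici_self (by rw [closure_Ioi])

end LocallyIntegrable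

/-! ### Locally absolutely continuous functions and integration by parts. -/

section AbsoluteContinuity

/-- Used with `re`, `im`, `ofReal` and conjugation: the fundamental theorem of calculus is applied
to real and imaginary parts and carried over to `ℂ`. -/
theorem _root_.LipschitzWith.comp_absolutelyContinuousOnInterval {X Y : Type*}
    [PseudoMetricSpace X] [PseudoMetricSpace Y] {K : NNReal} {φ : X → Y} (hφ : LipschitzWith K φ)
    {f : ℝ → X} {a b : ℝ} (hf : AbsolutelyContinuousOnInterval f a b) :
    AbsolutelyContinuousOnInterval (fun x => φ (f x)) a b := by
  refine squeeze_zero (fun E => Finset.sum_nonneg fun i _ => dist_nonneg) (fun E => ?_)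
    (by simpa using Filter.Tendsto.const_mul (K : ℝ) hf)
  rw [Finset.mul_sum]
  exact Finset.sum_le_sum fun i _ => hφ.dist_le_mul _ _

variable {u v g : ℝ → ℂ}

theorem ACLoc.add (hu : ACLoc u) (hv : ACLoc v) : ACLoc (u + v) :=
  fun s t hs ht => (hu s t hs ht).add (hv s t hs ht)

theorem ACLoc.mul (hu : ACLoc u) (hv : ACLoc v) : ACLoc (fun x => u x * v x) :=
  fun s t hs ht => (hu s t hs ht).smul (hv s t hs ht)

theorem ACLoc.const_smul (a : ℂ) (hu : ACLoc u) : ACLoc (a • u) :=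
  fun s t hs ht => (hu s t hs ht).const_smul a

theorem ACLoc.conj (hu : ACLoc u) : ACLoc (fun x => conj (u x)) :=
  fun s t hs ht => Complex.isometry_conj.lipschitz.comp_absolutelyContinuousOnInterval (hu s t hs ht)

theorem _root_.ContDiffOn.acLoc (hu : ContDiffOn ℝ 1 u (Ici 0)) : ACLoc u := fun _ _ hs ht =>
  (hu.mono fun _ hx => (le_inf hs ht).trans hx.1).absolutelyContinuousOnInterval

theorem ACLoc.continuousOn (hu : ACLoc u) : ContinuousOn u (Ici 0) := by
  intro x (hx : 0 ≤ x)
  have h := (hu 0 (x + 1) le_rfl (by linarith)).continuousOn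
  rw [uIcc_of_le (by linarith)] at h
  refine (h x ⟨hx, by linarith⟩).mono_of_mem_nhdsWithin ?_
  rw [← Ici_inter_Iic, inter_comm]
  exact Filter.inter_mem (mem_nhdsWithin_of_mem_nhds (Iic_mem_nhds (by linarith)))
    self_mem_nhdsWithin

theorem lipschitzWith_re : LipschitzWith 1 Complex.re := Complex.reCLM.lipschitz.weaken (by simp)

theorem lipschitzWith_im : LipschitzWith 1 Complex.im := Complex.imCLM.lipschitz.weaken (by simp)

theorem ACLoc.ae_differentiableAt_Icc (hu : ACLoc u) {t : ℝ} (ht : 0 ≤ t) :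
    ∀ᵐ x, x ∈ Icc 0 t → DifferentiableAt ℝ u x := by
  have := (hu 0 t le_rfl ht).boundedVariationOn.ae_differentiableAt_of_mem_uIcc
  rwa [uIcc_of_le ht] at this

theorem ACLoc.ae_differentiableAt (hu : ACLoc u) : ∀ᵐ x ∂halfLine, DifferentiableAt ℝ u x :=
  ae_halfLine_of_forall_Icc fun _ ht => hu.ae_differentiableAt_Icc ht

theorem deriv_eq_re_add_im {x : ℝ} (hx : DifferentiableAt ℝ u x) :
    deriv u x = ((deriv (fun t => (u t).re) x : ℝ) : ℂ) + deriv (fun t => (u t).im) x * Complex.I := by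
  have h1 : HasDerivAt (fun t => (u t).re) (deriv u x).re x :=
    Complex.reCLM.hasFDerivAt.comp_hasDerivAt x hx.hasDerivAt
  have h2 : HasDerivAt (fun t => (u t).im) (deriv u x).im x :=
    Complex.imCLM.hasFDerivAt.comp_hasDerivAt x hx.hasDerivAt
  rw [h1.deriv, h2.deriv, Complex.re_add_im]

theorem ACLoc.deriv_ae_eq (hu : ACLoc u) {t : ℝ} (ht : 0 ≤ t) :
    (fun x => ((deriv (fun t => (u t).re) x : ℝ) : ℂ) + deriv (fun t => (u t).im) x * Complex.I)
      =ᵐ[volume.restrict (uIoc 0 t)] deriv u := by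
  rw [Filter.EventuallyEq, ae_restrict_iff' measurableSet_uIoc]
  filter_upwards [hu.ae_differentiableAt_Icc ht] with x hx hx'
  rw [uIoc_of_le ht] at hx'
  exact (deriv_eq_re_add_im (hx (Ioc_subset_Icc_self hx'))).symm

theorem ACLoc.locallyIntegrable_deriv (hu : ACLoc u) : LocallyIntegrable (deriv u) halfLine := by
  refine locallyIntegrable_of_intervalIntegrable fun t ht => ?_
  have h := hu 0 t le_rfl ht
  have h1 := (lipschitzWith_re.comp_absolutelyContinuousOnInterval h).intervalIntegrable_deriv
  have h2 := (lipschitzWith_im.comp_absolutelyContinuousOnInterval h).intervalIntegrable_deriv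
  exact (h1.complexOfReal.add (h2.complexOfReal.mul_const Complex.I)).congr_ae
    (hu.deriv_ae_eq ht)

theorem ACLoc.integral_deriv (hu : ACLoc u) {t : ℝ} (ht : 0 ≤ t) :
    ∫ x in (0 : ℝ)..t, deriv u x = u t - u 0 := by
  have h := hu 0 t le_rfl ht
  have h1 := lipschitzWith_re.comp_absolutelyContinuousOnInterval h
  have h2 := lipschitzWith_im.comp_absolutelyContinuousOnInterval h
  rw [← intervalIntegral.integral_congr_ae_restrict (hu.deriv_ae_eq ht),
    intervalIntegral.integral_add h1.intervalIntegrable_deriv.complexOfReal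
      (h2.intervalIntegrable_deriv.complexOfReal.mul_const _), intervalIntegral.integral_mul_const,
    intervalIntegral.integral_ofReal, intervalIntegral.integral_ofReal, h1.integral_deriv_eq_sub,
    h2.integral_deriv_eq_sub]
  apply Complex.ext <;> simp

theorem acLoc_integral (hg : LocallyIntegrable g halfLine) :
    ACLoc (fun x => ∫ t in (0 : ℝ)..x, g t) := by
  intro s t hs ht
  have key : AbsolutelyContinuousOnInterval (fun x => ∫ t in (0 : ℝ)..x, g t) 0 (max s t) := by
    have hm : 0 ≤ max s t := hs.trans (le_max_left _ _)
    have hi := intervalIntegrable_of_locallyIntegrable hg le_rfl hm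
    have h1 : IntervalIntegrable (fun x => (g x).re) volume 0 (max s t) :=
      ⟨hi.1.re, hi.2.re⟩
    have h2 : IntervalIntegrable (fun x => (g x).im) volume 0 (max s t) :=
      ⟨hi.1.im, hi.2.im⟩
    have A1 := Complex.isometry_ofReal.lipschitz.comp_absolutelyContinuousOnInterval
      (h1.absolutelyContinuousOnInterval_intervalIntegral left_mem_uIcc)
    have A2 := Complex.isometry_ofReal.lipschitz.comp_absolutelyContinuousOnInterval
      (h2.absolutelyContinuousOnInterval_intervalIntegral left_mem_uIcc)
    have A := A1.add (A2.const_smul Complex.I)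
    have hE : EqOn (fun x => ∫ t in (0 : ℝ)..x, g t)
        ((fun x => ((∫ t in (0 : ℝ)..x, (g t).re : ℝ) : ℂ)) +
          fun x => Complex.I • ((∫ t in (0 : ℝ)..x, (g t).im : ℝ) : ℂ)) (uIcc 0 (max s t)) := by
      intro x hx
      rw [uIcc_of_le hm] at hx
      have hi' := intervalIntegrable_of_locallyIntegrable hg le_rfl hx.1
      have h1' : IntervalIntegrable (fun x => (g x).re) volume 0 x := ⟨hi'.1.re, hi'.2.re⟩
      have h2' : IntervalIntegrable (fun x => (g x).im) volume 0 x := ⟨hi'.1.im, hi'.2.im⟩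
      simp only [Pi.add_apply, smul_eq_mul]
      rw [← intervalIntegral.integral_ofReal, ← intervalIntegral.integral_ofReal,
        ← intervalIntegral.integral_const_mul, ← intervalIntegral.integral_add h1'.complexOfReal
          (h2'.complexOfReal.const_mul _)]
      refine intervalIntegral.integral_congr fun y _ => ?_
      simp only [mul_comm Complex.I, Complex.re_add_im]
    -- The decomposition is known only on `[0, max s t]`; the ε-δ form evaluates the functions at
    -- points of this interval only.
    rw [absolutelyContinuousOnInterval_iff] at A ⊢
    intro ε hε
    obtain ⟨δ, hδ, H⟩ := A ε hε
    refine ⟨δ, hδ, fun E hE1 hE2 => ?_⟩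
    convert H E hE1 hE2 using 1
    refine Finset.sum_congr rfl fun i hi => ?_
    exact congrArg₂ dist (hE (hE1.1 i hi).1) (hE (hE1.1 i hi).2)
  refine key.mono fun x hx => ?_
  rw [uIcc_of_le (hs.trans (le_max_left _ _))]
  exact ⟨(le_inf hs ht).trans hx.1, hx.2⟩

theorem ae_hasDerivAt_integral (hg : LocallyIntegrable g halfLine) :
    ∀ᵐ x ∂halfLine, HasDerivAt (fun x => ∫ t in (0 : ℝ)..x, g t) (g x) x := by
  refine ae_halfLine_of_forall_Icc fun t ht => ?_
  filter_upwards [(intervalIntegrable_of_locallyIntegrable hg le_rfl ht).ae_hasDerivAt_integral]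
    with x hx hx'
  rw [uIcc_of_le ht] at hx
  exact hx hx' 0 ⟨le_rfl, ht⟩

theorem integrable_deriv_mul_add (hu : ACLoc u) {φ : ℝ → ℂ} (hφ : φ ∈ testSpace 1) :
    Integrable (fun x => u x * deriv φ x + deriv u x * φ x) halfLine :=
  (integrable_mul_of_hasCompactSupport (locallyIntegrable_of_continuousOn hu.continuousOn)
    (hφ.1.continuous_deriv (by simp)) hφ.2.1.deriv).add
    (integrable_mul_of_hasCompactSupport hu.locallyIntegrable_deriv hφ.1.continuous hφ.2.1)

/-- Integration by parts against a test function. -/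
theorem integral_deriv_mul_add (hu : ACLoc u) {φ : ℝ → ℂ} (hφ : φ ∈ testSpace 1) :
    ∫ x, (u x * deriv φ x + deriv u x * φ x) ∂halfLine = 0 := by
  have hφd : Differentiable ℝ φ := hφ.1.differentiable (by simp)
  have hAC : ACLoc (fun x => u x * φ x) := hu.mul (ContDiffOn.acLoc (by simpa using hφ.1.contDiffOn))
  obtain ⟨R, hR⟩ := hφ.2.1.isCompact.bddAbove
  -- `R` may belong to the support; the added 1 places `T` strictly beyond it, so the boundary term
  -- at `T` vanishes.
  set T := max R 0 + 1
  have hT0 : 0 ≤ T := by positivity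
  have hRT : ∀ x, T ≤ x → x ∉ tsupport φ := fun x hx hx' => by
    have := hR hx'
    have := le_max_left R 0
    simp only [T] at hx
    linarith
  have h0 : φ 0 = 0 := image_eq_zero_of_notMem_tsupport fun h => lt_irrefl (0 : ℝ) (hφ.2.2 h)
  have hT : φ T = 0 := image_eq_zero_of_notMem_tsupport (hRT T le_rfl)
  have h := hAC.integral_deriv hT0
  rw [h0, hT, mul_zero, mul_zero, sub_zero, intervalIntegral.integral_of_le hT0] at h
  rw [← h, halfLine, setIntegral_eq_of_subset_of_forall_sdiff_eq_zero measurableSet_Ioi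
    (Ioc_subset_Ioi_self : Ioc 0 T ⊆ Ioi 0)]
  · refine setIntegral_congr_ae measurableSet_Ioc ?_
    filter_upwards [hu.ae_differentiableAt_Icc hT0] with x hx hx'
    rw [deriv_fun_mul (hx (Ioc_subset_Icc_self hx')) (hφd x)]
    ring
  · rintro x ⟨hx1, hx2⟩
    have hx3 : T ≤ x := by
      by_contra hlt
      exact hx2 ⟨hx1, (not_le.1 hlt).le⟩
    rw [image_eq_zero_of_notMem_tsupport (hRT x hx3),
      image_eq_zero_of_notMem_tsupport fun h => hRT x hx3 (tsupport_deriv_subset h)]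
    simp

end AbsoluteContinuity

/-! ### Test functions and the fundamental lemma. -/

section TestFunctions

/-- The coefficients are regular on the half-line only; off its support `g` vanishes locally, which
yields smoothness on all of `ℝ`. -/
theorem mem_testSpace_of_contDiffOn {j k : ℕ} {f g : ℝ → ℂ} (hf : f ∈ testSpace k)
    (hg : ContDiffOn ℝ j g (Ioi 0)) (hs : Function.support g ⊆ tsupport f) : g ∈ testSpace j := by
  have hts : tsupport g ⊆ tsupport f := closure_minimal hs (isClosed_tsupport f)
  refine ⟨contDiff_iff_contDiffAt.2 fun x => ?_, hf.2.1.mono' hs, hts.trans hf.2.2⟩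
  by_cases hx : x ∈ tsupport g
  · exact hg.contDiffAt (Ioi_mem_nhds (hf.2.2 (hts hx)))
  · exact contDiffAt_const.congr_of_eventuallyEq (notMem_tsupport_iff_eventuallyEq.1 hx)

theorem testSpace_mono {j k : ℕ} (hjk : j ≤ k) : testSpace k ≤ testSpace j :=
  fun _ hf => ⟨hf.1.of_le (by exact_mod_cast hjk), hf.2⟩

theorem integrable_mul_testSpace {k : ℕ} {F f : ℝ → ℂ} (hF : LocallyIntegrable F halfLine)
    (hf : f ∈ testSpace k) : Integrable (fun x => F x * f x) halfLine :=
  integrable_mul_of_hasCompactSupport hF hf.1.continuous hf.2.1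

/-- The fundamental lemma of the calculus of variations on the half-line. -/
theorem ae_eq_zero_of_forall_testSpace (k : ℕ) {F : ℝ → ℂ} (hF : LocallyIntegrable F halfLine)
    (h : ∀ f ∈ testSpace k, ∫ x, F x * f x ∂halfLine = 0) : F =ᵐ[halfLine] 0 := by
  have h0 := isOpen_Ioi.ae_eq_zero_of_integral_contDiff_smul_eq_zero (μ := halfLine)
    (U := Ioi (0 : ℝ)) (f := F) (hF.locallyIntegrableOn _) ?_
  · filter_upwards [h0, ae_restrict_mem measurableSet_Ioi] with x hx hx' using hx hx'
  · intro g hg hg' hg''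
    have hm : (fun x => (g x : ℂ)) ∈ testSpace k := by
      refine ⟨(Complex.ofRealCLM.contDiff.comp hg).of_le (by exact_mod_cast le_top),
        hg'.comp_left (g := ((↑) : ℝ → ℂ)) Complex.ofReal_zero, ?_⟩
      exact (closure_mono (Function.support_comp_subset Complex.ofReal_zero g)).trans hg''
    rw [← h _ hm]
    refine integral_congr_ae (ae_of_all _ fun x => ?_)
    simp [mul_comm]

end TestFunctions

/-! ### Inner products as integrals; density of the domain. -/

section InnerProducts

/-- The inner product is conjugate-linear in its first slot, so the weak equations below are
equations for `conj y`. -/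
theorem L2Sq.locallyIntegrable_conj (y : L2) :
    LocallyIntegrable (fun x => conj (y x)) halfLine :=
  (Lp.memLp y).star.locallyIntegrable (by norm_num)

theorem L2.integrable_conj_mul (y : L2) {F : ℝ → ℂ} (hF : MemLp F 2 halfLine) :
    Integrable (fun x => conj (y x) * F x) halfLine :=
  (Lp.memLp y).star.integrable_mul hF

theorem L2.inner_toLp (y : L2) {F : ℝ → ℂ} (hF : MemLp F 2 halfLine) :
    inner ℂ y (hF.toLp F) = ∫ x, conj (y x) * F x ∂halfLine := by
  rw [MeasureTheory.L2.inner_def]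
  refine integral_congr_ae ?_
  filter_upwards [hF.coeFn_toLp] with x hx
  rw [hx, RCLike.inner_apply, mul_comm]

theorem inner_toLp_toLp (y : L2Sq) {F₁ F₂ : ℝ → ℂ} (h₁ : MemLp F₁ 2 halfLine)
    (h₂ : MemLp F₂ 2 halfLine) :
    inner ℂ y (WithLp.toLp 2 (h₁.toLp F₁, h₂.toLp F₂) : L2Sq) =
      ∫ x, (conj (y.fst x) * F₁ x + conj (y.snd x) * F₂ x) ∂halfLine := by
  rw [WithLp.prod_inner_apply, integral_add (L2.integrable_conj_mul _ h₁)
    (L2.integrable_conj_mul _ h₂), ← L2.inner_toLp _ h₁, ← L2.inner_toLp _ h₂]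
  rfl

theorem integrable_inner_toLp_toLp (y : L2Sq) {F₁ F₂ : ℝ → ℂ} (h₁ : MemLp F₁ 2 halfLine)
    (h₂ : MemLp F₂ 2 halfLine) :
    Integrable (fun x => conj (y.fst x) * F₁ x + conj (y.snd x) * F₂ x) halfLine :=
  (L2.integrable_conj_mul _ h₁).add (L2.integrable_conj_mul _ h₂)

theorem inner_embed (y : L2Sq) (f : testSpace 2 × testSpace 1) :
    inner ℂ y (embed f) =
      ∫ x, (conj (y.fst x) * f.1.1 x + conj (y.snd x) * f.2.1 x) ∂halfLine :=
  inner_toLp_toLp _ (memLp_testSpace f.1.2) (memLp_testSpace f.2.2)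

/-- A vector orthogonal to all `(f, 0)` and `(0, f)` has both components zero by the fundamental
lemma. -/
theorem dense_range_embed : Dense (LinearMap.range embed : Set L2Sq) := by
  rw [Submodule.dense_iff_topologicalClosure_eq_top, Submodule.topologicalClosure_eq_top_iff,
    Submodule.eq_bot_iff]
  intro y hy
  have key (f : testSpace 2 × testSpace 1) :
      ∫ x, (conj (y.fst x) * f.1.1 x + conj (y.snd x) * f.2.1 x) ∂halfLine = 0 := by
    rw [← inner_embed]
    exact (Submodule.mem_orthogonal' _ _).1 hy _ (LinearMap.mem_range_self embed f)
  have e1 := ae_eq_zero_of_forall_testSpace 2 (L2Sq.locallyIntegrable_conj y.fst) fun f hf => by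
    simpa using key (⟨f, hf⟩, 0)
  have e2 := ae_eq_zero_of_forall_testSpace 1 (L2Sq.locallyIntegrable_conj y.snd) fun f hf => by
    simpa using key (0, ⟨f, hf⟩)
  have z1 : y.fst = 0 := by
    refine Lp.ext ?_
    filter_upwards [e1, Lp.coeFn_zero ℂ 2 halfLine] with x hx hx'
    rw [hx']
    simpa using hx
  have z2 : y.snd = 0 := by
    refine Lp.ext ?_
    filter_upwards [e2, Lp.coeFn_zero ℂ 2 halfLine] with x hx hx'
    rw [hx']
    simpa using hx
  exact (WithLp.ofLp_injective 2) (Prod.ext z1 z2)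

end InnerProducts

/-! ### Green's formula, symmetry, uniqueness of representatives. -/

section Green

variable {p q d : ℝ → ℝ} {b c : ℝ → ℂ}

/-- The flux `p f₁' + b̄ f₂` of a pair of test functions. -/
noncomputable def flux (p : ℝ → ℝ) (b : ℝ → ℂ) (f₁ f₂ : ℝ → ℂ) : ℝ → ℂ := fun x =>
  (p x : ℂ) * deriv f₁ x + conj (b x) * f₂ x

theorem CoeffHyp.flux1_mem (h : CoeffHyp p q d b c) {f₁ : ℝ → ℂ} (h₁ : f₁ ∈ testSpace 2) :
    (fun t => (p t : ℂ) * deriv f₁ t) ∈ testSpace 1 :=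
  mem_testSpace_of_contDiffOn h₁ (by simpa using h.contDiffOn_flux1 h₁)
    (support_mul_deriv_subset _ _)

theorem CoeffHyp.flux2_mem (h : CoeffHyp p q d b c) {f₂ : ℝ → ℂ} (h₂ : f₂ ∈ testSpace 1) :
    (fun t => conj (b t) * f₂ t) ∈ testSpace 1 :=
  mem_testSpace_of_contDiffOn h₂ (by simpa using h.contDiffOn_flux2 h₂)
    ((Function.support_mul_subset_right _ _).trans (subset_tsupport _))

theorem CoeffHyp.flux_mem (h : CoeffHyp p q d b c) {f₁ f₂ : ℝ → ℂ} (h₁ : f₁ ∈ testSpace 2)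
    (h₂ : f₂ ∈ testSpace 1) : flux p b f₁ f₂ ∈ testSpace 1 :=
  (testSpace 1).add_mem (h.flux1_mem h₁) (h.flux2_mem h₂)

theorem CoeffHyp.deriv_flux (h : CoeffHyp p q d b c) {f₁ f₂ : ℝ → ℂ} (h₁ : f₁ ∈ testSpace 2)
    (h₂ : f₂ ∈ testSpace 1) (x : ℝ) :
    deriv (flux p b f₁ f₂) x =
      deriv (fun t => (p t : ℂ) * deriv f₁ t) x + deriv (fun t => conj (b t) * f₂ t) x :=
  deriv_fun_add ((h.flux1_mem h₁).1.differentiable (by simp) x)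
    ((h.flux2_mem h₂).1.differentiable (by simp) x)

theorem deriv_conj (u : ℝ → ℂ) (x : ℝ) : deriv (fun t => conj (u t)) x = conj (deriv u x) :=
  deriv.star

/-- Green's formula: the expression defining the maximal operator is formally adjoint to `𝒜₀`. -/
theorem IsACRep.inner_action (h : CoeffHyp p q d b c) {y : L2Sq} {u v : ℝ → ℂ}
    (hr : IsACRep p b y u v) (m₁ : MemLp (maxRow1 q c u v y.snd) 2 halfLine)
    (m₂ : MemLp (row2 d b c u y.snd) 2 halfLine) (f : testSpace 2 × testSpace 1) :
    inner ℂ (WithLp.toLp 2 (m₁.toLp _, m₂.toLp _) : L2Sq) (embed f) = inner ℂ y (action h f) := by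
  obtain ⟨⟨f₁, h₁⟩, ⟨f₂, h₂⟩⟩ := f
  set w : L2Sq := WithLp.toLp 2 (m₁.toLp _, m₂.toLp _)
  have hφ := h.flux_mem h₁ h₂
  have i1 := integrable_deriv_mul_add hr.u_ac.conj hφ
  have i2 := integrable_deriv_mul_add hr.v_ac.conj (testSpace_mono one_le_two h₁)
  -- With `φ` the flux of the test pair, the two integrands differ by `(ū φ)' - (v̄ f₁)'`, both of
  -- which integrate to zero.
  have e : (fun x => conj (w.fst x) * f₁ x + conj (w.snd x) * f₂ x) =ᵐ[halfLine]
      fun x => (conj (y.fst x) * row1 p q b c f₁ f₂ x + conj (y.snd x) * row2 d b c f₁ f₂ x) +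
        (((conj (u x) * deriv (flux p b f₁ f₂) x +
          deriv (fun t => conj (u t)) x * flux p b f₁ f₂ x)) -
        (conj (v x) * deriv f₁ x + deriv (fun t => conj (v t)) x * f₁ x)) := by
    filter_upwards [hr.u_eq, hr.v_eq, m₁.coeFn_toLp, m₂.coeFn_toLp] with x hu hv hm1 hm2
    have w1 : w.fst x = maxRow1 q c u v y.snd x := hm1
    have w2 : w.snd x = row2 d b c u y.snd x := hm2
    rw [w1, w2, ← hu, hv, h.deriv_flux h₁ h₂, deriv_conj, deriv_conj]
    simp only [maxRow1, row1, row2, flux, map_add, map_mul, map_neg, Complex.conj_conj,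
      Complex.conj_ofReal]
    ring
  rw [inner_embed, integral_congr_ae e, integral_add ?_ ?_, integral_sub i1 i2,
    integral_deriv_mul_add hr.u_ac.conj hφ,
    integral_deriv_mul_add hr.v_ac.conj (testSpace_mono one_le_two h₁), sub_zero, add_zero]
  · exact (inner_toLp_toLp y (h.memLp_row1 h₁ h₂) (h.memLp_row2 h₁ h₂)).symm
  · exact integrable_inner_toLp_toLp y (h.memLp_row1 h₁ h₂) (h.memLp_row2 h₁ h₂)
  · exact i1.sub i2

theorem ACLoc.of_testSpace {f : ℝ → ℂ} (hf : f ∈ testSpace 1) : ACLoc f :=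
  ContDiffOn.acLoc (by simpa using hf.1.contDiffOn)

theorem isACRep_embed (h : CoeffHyp p q d b c) (f : testSpace 2 × testSpace 1) :
    IsACRep p b (embed f) f.1.1 (flux p b f.1.1 f.2.1) where
  u_ac := .of_testSpace (testSpace_mono one_le_two f.1.2)
  v_ac := .of_testSpace (h.flux_mem f.1.2 f.2.2)
  u_eq := (memLp_testSpace f.1.2).coeFn_toLp.symm
  v_eq := by
    filter_upwards [(memLp_testSpace f.2.2).coeFn_toLp] with x hx
    have : (embed f).snd x = f.2.1 x := hx
    rw [this, flux]

/-- Green's formula with `y = embed f`: a test pair is represented by its own first component and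
flux. -/
theorem inner_action_embed (h : CoeffHyp p q d b c) (f g : testSpace 2 × testSpace 1) :
    inner ℂ (action h f) (embed g) = inner ℂ (embed f) (action h g) := by
  have e1 : row1 p q b c f.1.1 f.2.1 =ᵐ[halfLine]
      maxRow1 q c f.1.1 (flux p b f.1.1 f.2.1) (embed f).snd := by
    filter_upwards [(memLp_testSpace f.2.2).coeFn_toLp] with x hx
    have : (embed f).snd x = f.2.1 x := hx
    rw [maxRow1, row1, this, h.deriv_flux f.1.2 f.2.2]
    ring
  have e2 : row2 d b c f.1.1 f.2.1 =ᵐ[halfLine] row2 d b c f.1.1 (embed f).snd := by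
    filter_upwards [(memLp_testSpace f.2.2).coeFn_toLp] with x hx
    have : (embed f).snd x = f.2.1 x := hx
    rw [row2, row2, this]
  have m1 := (memLp_congr_ae e1).1 (h.memLp_row1 f.1.2 f.2.2)
  have m2 := (memLp_congr_ae e2).1 (h.memLp_row2 f.1.2 f.2.2)
  rw [← (isACRep_embed h f).inner_action h m1 m2 g]
  refine congrArg (fun w => inner ℂ w (embed g)) (congrArg (WithLp.toLp 2) ?_)
  exact Prod.ext ((MemLp.toLp_eq_toLp_iff (h.memLp_row1 f.1.2 f.2.2) m1).2 e1)
    ((MemLp.toLp_eq_toLp_iff (h.memLp_row2 f.1.2 f.2.2) m2).2 e2)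

theorem forall_domain_opA0 (h : CoeffHyp p q d b c) {P : (opA0 h).domain → Prop}
    (hP : ∀ f, P ⟨embed f, LinearMap.mem_range_self embed f⟩) : ∀ x, P x := by
  rintro ⟨_, f, rfl⟩
  exact hP f

theorem isFormalAdjoint_opA0 (h : CoeffHyp p q d b c) : (opA0 h).IsFormalAdjoint (opA0 h) := by
  refine forall_domain_opA0 h fun f => forall_domain_opA0 h fun g => ?_
  rw [opA0_apply, opA0_apply]
  exact inner_action_embed h f g

theorem IsACRep.inner_opA0 (h : CoeffHyp p q d b c) {y : L2Sq} {u v : ℝ → ℂ}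
    (hr : IsACRep p b y u v) (m₁ : MemLp (maxRow1 q c u v y.snd) 2 halfLine)
    (m₂ : MemLp (row2 d b c u y.snd) 2 halfLine) (x : (opA0 h).domain) :
    inner ℂ (WithLp.toLp 2 (m₁.toLp _, m₂.toLp _) : L2Sq) (x : L2Sq) =
      inner ℂ y (opA0 h x) := by
  revert x
  refine forall_domain_opA0 h fun f => ?_
  rw [opA0_apply]
  exact hr.inner_action h m₁ m₂ f

/-- The representatives `u` and `v` are determined on `[0, ∞)`. -/
theorem IsACRep.eqOn {y : L2Sq} {u v u' v' : ℝ → ℂ} (hr : IsACRep p b y u v)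
    (hr' : IsACRep p b y u' v') : EqOn u u' (Ici 0) ∧ EqOn v v' (Ici 0) := by
  have hu := eqOn_Ici_of_ae_eq hr.u_ac.continuousOn hr'.u_ac.continuousOn
    (hr.u_eq.trans hr'.u_eq.symm)
  refine ⟨hu, eqOn_Ici_of_ae_eq hr.v_ac.continuousOn hr'.v_ac.continuousOn ?_⟩
  filter_upwards [hr.v_eq, hr'.v_eq, ae_restrict_mem measurableSet_Ioi] with x h1 h2 hx
  rw [h1, h2, ((hu.mono Ioi_subset_Ici_self).eventuallyEq_of_mem (Ioi_mem_nhds hx)).deriv_eq]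

theorem deriv_eq_of_eqOn_Ici {u v : ℝ → ℂ} (huv : EqOn u v (Ici 0)) {x : ℝ} (hx : 0 < x) :
    deriv u x = deriv v x :=
  (huv.eventuallyEq_of_mem (Ici_mem_nhds hx)).deriv_eq

theorem IsACRep.maxRow1_ae_eq {y : L2Sq} {u v u' v' : ℝ → ℂ} (hr : IsACRep p b y u v)
    (hr' : IsACRep p b y u' v') :
    maxRow1 q c u v y.snd =ᵐ[halfLine] maxRow1 q c u' v' y.snd := by
  filter_upwards [ae_restrict_mem measurableSet_Ioi] with x hx
  rw [maxRow1, maxRow1, deriv_eq_of_eqOn_Ici (hr.eqOn hr').2 hx,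
    (hr.eqOn hr').1 (Ioi_subset_Ici_self hx)]

theorem IsACRep.row2_ae_eq {y : L2Sq} {u v u' v' : ℝ → ℂ} (hr : IsACRep p b y u v)
    (hr' : IsACRep p b y u' v') :
    row2 d b c u y.snd =ᵐ[halfLine] row2 d b c u' y.snd := by
  filter_upwards [ae_restrict_mem measurableSet_Ioi] with x hx
  rw [row2, row2, deriv_eq_of_eqOn_Ici (hr.eqOn hr').1 hx, (hr.eqOn hr').1 (Ioi_subset_Ici_self hx)]

end Green

/-! ### A second order du Bois-Reymond lemma. -/

section DuBoisReymond

theorem exists_tsupport_subset_Icc {k : ℕ} {φ : ℝ → ℂ} (hφ : φ ∈ testSpace k) :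
    ∃ a b : ℝ, 0 < a ∧ a ≤ b ∧ tsupport φ ⊆ Icc a b := by
  obtain hK | hK := (tsupport φ).eq_empty_or_nonempty
  · exact ⟨1, 1, one_pos, le_rfl, by simp [hK]⟩
  · obtain ⟨a, ha, ha'⟩ := hφ.2.1.isCompact.exists_isLeast hK
    obtain ⟨b, hb, hb'⟩ := hφ.2.1.isCompact.exists_isGreatest hK
    exact ⟨a, b, hφ.2.2 ha, ha' hb, fun x hx => ⟨ha' hx, hb' hx⟩⟩

/-- A test function of vanishing integral has an antiderivative among the test functions. -/
theorem exists_testSpace_deriv_eq {k : ℕ} {φ : ℝ → ℂ} (hφ : φ ∈ testSpace k)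
    (h0 : ∫ x, φ x ∂halfLine = 0) : ∃ Φ ∈ testSpace (k + 1), deriv Φ = φ := by
  obtain ⟨a, b, ha, hab, hs⟩ := exists_tsupport_subset_Icc hφ
  have hz : ∀ x, x ∉ Icc a b → φ x = 0 := fun x hx =>
    image_eq_zero_of_notMem_tsupport fun h => hx (hs h)
  have hd : ∀ x, HasDerivAt (fun x => ∫ t in (0 : ℝ)..x, φ t) (φ x) x := fun x =>
    (hφ.1.continuous.integral_hasStrictDerivAt 0 x).hasDerivAt
  have hd' : deriv (fun x => ∫ t in (0 : ℝ)..x, φ t) = φ := funext fun x => (hd x).deriv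
  have hsupp : Function.support (fun x => ∫ t in (0 : ℝ)..x, φ t) ⊆ Icc a b := by
    intro x hx
    by_contra hxab
    refine hx ?_
    -- Left of `[a, b]` the integrand is zero; right of it the integral is the total one, zero by
    -- `h0`.
    rcases lt_or_ge x a with hxa | hxa
    · refine (intervalIntegral.integral_congr fun t ht => ?_).trans
        (intervalIntegral.integral_zero (a := 0) (b := x))
      exact hz t fun h => absurd h.1 (not_le.2 (ht.2.trans_lt (sup_lt_iff.2 ⟨ha, hxa⟩)))
    · have hbx : b < x := not_le.1 fun h => hxab ⟨hxa, h⟩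
      simp only
      rw [intervalIntegral.integral_of_le (ha.le.trans hxa), ← h0, halfLine]
      refine (setIntegral_eq_of_subset_of_forall_sdiff_eq_zero measurableSet_Ioi
        Ioc_subset_Ioi_self fun t ht => hz t fun h => ht.2 ⟨ht.1, h.2.trans hbx.le⟩).symm
  have hts : tsupport (fun x => ∫ t in (0 : ℝ)..x, φ t) ⊆ Icc a b :=
    closure_minimal hsupp isClosed_Icc
  refine ⟨_, ⟨?_, ?_, hts.trans fun x hx => ha.trans_le hx.1⟩, hd'⟩
  · rw [Nat.cast_add, Nat.cast_one, contDiff_succ_iff_deriv, hd']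
    exact ⟨fun x => (hd x).differentiableAt, by simp, hφ.1⟩
  · exact isCompact_Icc.of_isClosed_subset (isClosed_tsupport _) hts

/-- Integration of test functions against a locally integrable function. -/
noncomputable def pairing (k : ℕ) {F : ℝ → ℂ} (hF : LocallyIntegrable F halfLine) :
    testSpace k →ₗ[ℂ] ℂ where
  toFun f := ∫ x, F x * f.1 x ∂halfLine
  map_add' f g := by
    rw [← integral_add (integrable_mul_testSpace hF f.2) (integrable_mul_testSpace hF g.2)]
    exact integral_congr_ae (ae_of_all _ fun x => mul_add _ _ _)
  map_smul' a f := by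
    rw [RingHom.id_apply, smul_eq_mul, ← integral_const_mul]
    exact integral_congr_ae (ae_of_all _ fun x => mul_left_comm _ _ _)

variable {p q d : ℝ → ℝ} {b c : ℝ → ℂ}

theorem CoeffHyp.p_ne_zero (h : CoeffHyp p q d b c) {x : ℝ} (hx : 0 ≤ x) : (p x : ℂ) ≠ 0 :=
  Complex.ofReal_ne_zero.2 (h.p_pos x hx).ne'

theorem CoeffHyp.continuousOn_p (h : CoeffHyp p q d b c) :
    ContinuousOn (fun x => (p x : ℂ)) (Ici 0) :=
  Complex.continuous_ofReal.comp_continuousOn h.p_contDiffOn.continuousOn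

theorem CoeffHyp.continuousOn_q (h : CoeffHyp p q d b c) :
    ContinuousOn (fun x => (q x : ℂ)) (Ici 0) :=
  Complex.continuous_ofReal.comp_continuousOn h.q_continuousOn

theorem CoeffHyp.continuousOn_d (h : CoeffHyp p q d b c) :
    ContinuousOn (fun x => (d x : ℂ)) (Ici 0) :=
  Complex.continuous_ofReal.comp_continuousOn h.d_contDiffOn.continuousOn

theorem CoeffHyp.continuousOn_conj_b (h : CoeffHyp p q d b c) :
    ContinuousOn (fun x => conj (b x)) (Ici 0) :=
  Complex.continuous_conj.comp_continuousOn h.b_contDiffOn.continuousOn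

theorem CoeffHyp.continuousOn_conj_c (h : CoeffHyp p q d b c) :
    ContinuousOn (fun x => conj (c x)) (Ici 0) :=
  Complex.continuous_conj.comp_continuousOn h.c_contDiffOn.continuousOn

theorem CoeffHyp.continuousOn_inv_p (h : CoeffHyp p q d b c) :
    ContinuousOn (fun x => (p x : ℂ)⁻¹) (Ici 0) :=
  h.continuousOn_p.inv₀ fun _ hx => h.p_ne_zero hx

/-- A second order du Bois-Reymond lemma: a function orthogonal to the range of `f ↦ (p f')'` on
test functions is a linear combination of `1` and `∫ 1 / p`. -/
theorem CoeffHyp.ae_eq_add_mul_integral_inv (h : CoeffHyp p q d b c) {F : ℝ → ℂ}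
    (hF : LocallyIntegrable F halfLine)
    (H : ∀ f ∈ testSpace 2, ∫ x, F x * deriv (fun t => (p t : ℂ) * deriv f t) x ∂halfLine = 0) :
    ∃ α β : ℂ, F =ᵐ[halfLine] fun x => α + β * ∫ t in (0 : ℝ)..x, (p t : ℂ)⁻¹ := by
  have hRi := locallyIntegrable_of_continuousOn h.continuousOn_inv_p
  set P : ℝ → ℂ := fun x => ∫ t in (0 : ℝ)..x, (p t : ℂ)⁻¹
  have hP : ACLoc P := acLoc_integral hRi
  have hPi := locallyIntegrable_of_continuousOn hP.continuousOn
  have h1 : LocallyIntegrable (fun _ : ℝ => (1 : ℂ)) halfLine :=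
    locallyIntegrable_of_continuousOn continuousOn_const
  -- A functional vanishing on the common kernel of finitely many functionals is a linear
  -- combination of them.
  have hspan : pairing 0 hF ∈ Submodule.span ℂ (range ![pairing 0 h1, pairing 0 hPi]) := by
    refine mem_span_of_iInf_ker_le_ker fun ψ hψ => ?_
    rw [Submodule.mem_iInf] at hψ
    have z1 : ∫ x, (1 : ℂ) * ψ.1 x ∂halfLine = 0 := hψ 0
    have z2 : ∫ x, P x * ψ.1 x ∂halfLine = 0 := hψ 1
    simp only [one_mul] at z1
    -- Goal: `ψ = (p f')'`. Zero mean gives `ψ = φ'`; by parts, `∫ P φ' = 0` becomes `∫ φ / p = 0`,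
    -- so `φ / p = f'`.
    obtain ⟨φ, hφ, hφd⟩ := exists_testSpace_deriv_eq ψ.2 z1
    have hg : (fun x => (p x : ℂ)⁻¹ * φ x) ∈ testSpace 1 := by
      refine mem_testSpace_of_contDiffOn hφ ?_
        ((Function.support_mul_subset_right _ _).trans (subset_tsupport _))
      exact (h.contDiffOn_p.inv fun x hx => h.p_ne_zero (le_of_lt hx)).mul
        (by simpa using hφ.1.contDiffOn)
    have z3 : ∫ x, (p x : ℂ)⁻¹ * φ x ∂halfLine = 0 := by
      rw [← integral_deriv_mul_add hP hφ, ← sub_eq_zero, ← integral_sub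
        (integrable_mul_testSpace hRi hφ) (integrable_deriv_mul_add hP hφ), ← neg_eq_zero,
        ← integral_neg, ← z2]
      refine integral_congr_ae ?_
      filter_upwards [ae_hasDerivAt_integral hRi] with x hx
      have : deriv P x = (p x : ℂ)⁻¹ := hx.deriv
      rw [this, hφd]
      ring
    obtain ⟨f, hf, hfd⟩ := exists_testSpace_deriv_eq hg z3
    have hpf : (fun t => (p t : ℂ) * deriv f t) = φ := by
      funext t
      rw [hfd]
      by_cases ht : t ∈ tsupport φ
      · rw [mul_inv_cancel_left₀ (h.p_ne_zero (le_of_lt (hφ.2.2 ht)))]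
      · simp [image_eq_zero_of_notMem_tsupport ht]
    have := H f hf
    rw [hpf, hφd] at this
    exact this
  obtain ⟨a, ha⟩ := (Submodule.mem_span_range_iff_exists_fun ℂ).1 hspan
  rw [Fin.sum_univ_two] at ha
  refine ⟨a 0, a 1, ?_⟩
  have hPc : LocallyIntegrable (fun x => a 0 + a 1 * P x) halfLine :=
    locallyIntegrable_of_continuousOn
      (continuousOn_const.add (continuousOn_const.mul hP.continuousOn))
  have key := ae_eq_zero_of_forall_testSpace 0 (hF.sub hPc) fun ψ hψ => by
    have e := LinearMap.congr_fun ha ⟨ψ, hψ⟩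
    have e' : a 0 * ∫ x, (1 : ℂ) * ψ x ∂halfLine + a 1 * ∫ x, P x * ψ x ∂halfLine =
      ∫ x, F x * ψ x ∂halfLine := e
    simp only [Pi.sub_apply, sub_mul, add_mul, mul_assoc]
    have j1 := (integrable_mul_testSpace h1 hψ).const_mul (a 0)
    have j2 := (integrable_mul_testSpace hPi hψ).const_mul (a 1)
    simp only [one_mul] at j1 e'
    rw [integral_sub (integrable_mul_testSpace hF hψ) (by exact j1.add j2), integral_add j1 j2,
      integral_const_mul, integral_const_mul, e', sub_self]
  filter_upwards [key] with x hx
  exact sub_eq_zero.1 hx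

end DuBoisReymond

/-! ### Regularity of elements of the adjoint domain. -/

section AdjointDomain

variable {p q d : ℝ → ℝ} {b c : ℝ → ℂ}

theorem CoeffHyp.exists_acLoc_of_integral_row_left (h : CoeffHyp p q d b c) {Y₁ Y₂ W₁ : ℝ → ℂ}
    (iY₁ : LocallyIntegrable Y₁ halfLine) (iY₂ : LocallyIntegrable Y₂ halfLine)
    (iW₁ : LocallyIntegrable W₁ halfLine)
    (hi : ∀ f ∈ testSpace 2,
      Integrable (fun x => Y₁ x * row1 p q b c f 0 x + Y₂ x * row2 d b c f 0 x) halfLine)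
    (hw : ∀ f ∈ testSpace 2, ∫ x, W₁ x * f x ∂halfLine =
      ∫ x, (Y₁ x * row1 p q b c f 0 x + Y₂ x * row2 d b c f 0 x) ∂halfLine) :
    ∃ U V : ℝ → ℂ, ACLoc U ∧ ACLoc V ∧ U =ᵐ[halfLine] Y₁ ∧
      (V =ᵐ[halfLine] fun x => (p x : ℂ) * deriv U x + b x * Y₂ x) ∧
      (deriv V =ᵐ[halfLine] fun x => (q x : ℂ) * Y₁ x + c x * Y₂ x - W₁ x) := by
  -- `G` is the derivative the first row forces on the flux, and `N` below is the derivative of `Y₁`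
  -- if the flux is `H`. Since `H` and `K` are just some primitives, `Y₁` is recovered up to two
  -- constants.
  set G : ℝ → ℂ := fun x => (q x : ℂ) * Y₁ x + c x * Y₂ x - W₁ x with hG
  have iG : LocallyIntegrable G halfLine :=
    ((locallyIntegrable_continuousOn_mul iY₁ h.continuousOn_q).add
      (locallyIntegrable_continuousOn_mul iY₂ h.c_contDiffOn.continuousOn)).sub iW₁
  obtain ⟨H, acH, dH⟩ : ∃ H, ACLoc H ∧ ∀ᵐ x ∂halfLine, HasDerivAt H (G x) x :=
    ⟨_, acLoc_integral iG, ae_hasDerivAt_integral iG⟩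
  set N : ℝ → ℂ := fun x => (p x : ℂ)⁻¹ * (H x - b x * Y₂ x) with hN
  have iN : LocallyIntegrable N halfLine :=
    locallyIntegrable_continuousOn_mul ((locallyIntegrable_of_continuousOn acH.continuousOn).sub
      (locallyIntegrable_continuousOn_mul iY₂ h.b_contDiffOn.continuousOn)) h.continuousOn_inv_p
  obtain ⟨K, acK, dK⟩ : ∃ K, ACLoc K ∧ ∀ᵐ x ∂halfLine, HasDerivAt K (N x) x :=
    ⟨_, acLoc_integral iN, ae_hasDerivAt_integral iN⟩
  have key (f : ℝ → ℂ) (hf : f ∈ testSpace 2) :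
      ∫ x, (K x - Y₁ x) * deriv (fun t => (p t : ℂ) * deriv f t) x ∂halfLine = 0 := by
    have hφ := h.flux1_mem hf
    have hf1 := testSpace_mono one_le_two hf
    have j1 := integrable_deriv_mul_add acK hφ
    have j2 := integrable_deriv_mul_add acH hf1
    have j3 := integrable_mul_testSpace iW₁ hf
    have j4 := hi f hf
    -- The last two groups are the total derivatives of `K p f'` and `H f`, so only the weak
    -- equation remains.
    calc _ = ∫ x, ((Y₁ x * row1 p q b c f 0 x + Y₂ x * row2 d b c f 0 x - W₁ x * f x) +
            ((K x * deriv (fun t => (p t : ℂ) * deriv f t) x +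
              deriv K x * ((p x : ℂ) * deriv f x)) -
            (H x * deriv f x + deriv H x * f x))) ∂halfLine := by
          refine integral_congr_ae ?_
          filter_upwards [dH, dK, ae_restrict_mem measurableSet_Ioi] with x h1 h2 hx
          have hp := h.p_ne_zero (le_of_lt hx)
          rw [h1.deriv, h2.deriv]
          simp only [hG, hN, row1, row2, Pi.zero_apply, mul_zero, deriv_const]
          field_simp
          ring
      _ = 0 := by
          rw [integral_add (by exact j4.sub j3) (by exact j1.sub j2), integral_sub j1 j2,
            integral_deriv_mul_add acK hφ, integral_deriv_mul_add acH hf1, integral_sub j4 j3,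
            hw f hf]
          simp
  obtain ⟨α, β, hαβ⟩ := h.ae_eq_add_mul_integral_inv
    ((locallyIntegrable_of_continuousOn acK.continuousOn).sub iY₁) key
  have iR := locallyIntegrable_of_continuousOn h.continuousOn_inv_p
  have acP := acLoc_integral iR
  have dP := ae_hasDerivAt_integral iR
  set P : ℝ → ℂ := fun x => ∫ t in (0 : ℝ)..x, (p t : ℂ)⁻¹
  have dV : ∀ᵐ x ∂halfLine, HasDerivAt (fun x => H x - β) (G x) x := by
    filter_upwards [dH] with x h1 using h1.sub_const β
  -- Since `p P' = 1`, correcting `K` by `β P` shifts the flux by the constant `β`.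
  refine ⟨fun x => K x - (α + β * P x), fun x => H x - β, ?_, ?_, ?_, ?_, ?_⟩
  · convert (acK.add (acP.const_smul (-β))).add (ContDiffOn.acLoc (contDiffOn_const (c := -α)))
      using 1
    funext x
    simp only [Pi.add_apply, Pi.smul_apply, smul_eq_mul]
    ring
  · convert acH.add (ContDiffOn.acLoc (contDiffOn_const (c := -β))) using 1
    exact funext fun x => sub_eq_add_neg _ _
  · filter_upwards [hαβ] with x hx
    rw [← hx, Pi.sub_apply, sub_sub_cancel]
  · filter_upwards [dK, dP, ae_restrict_mem measurableSet_Ioi] with x h1 h2 hx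
    have hp := h.p_ne_zero (le_of_lt hx)
    rw [(h1.fun_sub ((h2.const_mul β).const_add α)).deriv]
    simp only [hN]
    field_simp
    ring
  · filter_upwards [dV] with x hx using hx.deriv

/-- Once `Y₁` has the representative `U`, the single derivative on `b̄ f` is moved onto `U` and the
fundamental lemma applies. -/
theorem CoeffHyp.ae_eq_of_integral_row_right (h : CoeffHyp p q d b c) {Y₁ Y₂ W₂ U : ℝ → ℂ}
    (iY₂ : LocallyIntegrable Y₂ halfLine) (iW₂ : LocallyIntegrable W₂ halfLine) (acU : ACLoc U)
    (eU : U =ᵐ[halfLine] Y₁)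
    (hi : ∀ f ∈ testSpace 1,
      Integrable (fun x => Y₁ x * row1 p q b c 0 f x + Y₂ x * row2 d b c 0 f x) halfLine)
    (hw : ∀ f ∈ testSpace 1, ∫ x, W₂ x * f x ∂halfLine =
      ∫ x, (Y₁ x * row1 p q b c 0 f x + Y₂ x * row2 d b c 0 f x) ∂halfLine) :
    (fun x => conj (b x) * deriv U x + conj (c x) * U x + (d x : ℂ) * Y₂ x) =ᵐ[halfLine] W₂ := by
  have iS := (((locallyIntegrable_continuousOn_mul acU.locallyIntegrable_deriv
    h.continuousOn_conj_b).add (locallyIntegrable_continuousOn_mul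
      (locallyIntegrable_of_continuousOn acU.continuousOn) h.continuousOn_conj_c)).add
    (locallyIntegrable_continuousOn_mul iY₂ h.continuousOn_d)).sub iW₂
  have zS := ae_eq_zero_of_forall_testSpace 1 iS fun f hf => by
    have hφ := h.flux2_mem hf
    have j1 := integrable_deriv_mul_add acU hφ
    have j3 := integrable_mul_testSpace iW₂ hf
    have j4 := hi f hf
    calc _ = ∫ x, ((Y₁ x * row1 p q b c 0 f x + Y₂ x * row2 d b c 0 f x - W₂ x * f x) +
            (U x * deriv (fun t => conj (b t) * f t) x +
              deriv U x * (conj (b x) * f x))) ∂halfLine := by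
          refine integral_congr_ae ?_
          filter_upwards [eU] with x h1
          rw [← h1]
          have hz : deriv (0 : ℝ → ℂ) = 0 := funext fun t => deriv_const t 0
          simp only [row1, row2, hz, Pi.zero_apply, mul_zero, deriv_const, Pi.add_apply,
            Pi.sub_apply]
          ring
      _ = 0 := by
          rw [integral_add (by exact j4.sub j3) j1, integral_deriv_mul_add acU hφ,
            integral_sub j4 j3, hw f hf]
          simp
  filter_upwards [zS] with x hx
  exact sub_eq_zero.1 hx

theorem CoeffHyp.exists_isACRep_of_inner_eq (h : CoeffHyp p q d b c) {y w : L2Sq}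
    (hyw : ∀ f, inner ℂ w (embed f) = inner ℂ y (action h f)) :
    ∃ u v : ℝ → ℂ, IsACRep p b y u v ∧ maxRow1 q c u v y.snd =ᵐ[halfLine] w.fst ∧
      row2 d b c u y.snd =ᵐ[halfLine] w.snd := by
  have hyw' (f : testSpace 2 × testSpace 1) :
      ∫ x, (conj (w.fst x) * f.1.1 x + conj (w.snd x) * f.2.1 x) ∂halfLine =
        ∫ x, (conj (y.fst x) * row1 p q b c f.1.1 f.2.1 x +
          conj (y.snd x) * row2 d b c f.1.1 f.2.1 x) ∂halfLine := by
    rw [← inner_embed, hyw]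
    exact inner_toLp_toLp y (h.memLp_row1 f.1.2 f.2.2) (h.memLp_row2 f.1.2 f.2.2)
  have hint (f : testSpace 2 × testSpace 1) :
      Integrable (fun x => conj (y.fst x) * row1 p q b c f.1.1 f.2.1 x +
        conj (y.snd x) * row2 d b c f.1.1 f.2.1 x) halfLine :=
    integrable_inner_toLp_toLp y (h.memLp_row1 f.1.2 f.2.2) (h.memLp_row2 f.1.2 f.2.2)
  obtain ⟨U, V, acU, acV, eU, eV, dV⟩ := h.exists_acLoc_of_integral_row_left
    (L2Sq.locallyIntegrable_conj y.fst) (L2Sq.locallyIntegrable_conj y.snd)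
    (L2Sq.locallyIntegrable_conj w.fst) (fun f hf => hint (⟨f, hf⟩, 0))
    (fun f hf => by simpa using hyw' (⟨f, hf⟩, 0))
  have e2 := h.ae_eq_of_integral_row_right (L2Sq.locallyIntegrable_conj y.snd)
    (L2Sq.locallyIntegrable_conj w.snd) acU eU (fun f hf => hint (0, ⟨f, hf⟩))
    (fun f hf => by simpa using hyw' (0, ⟨f, hf⟩))
  refine ⟨fun x => conj (U x), fun x => conj (V x), ⟨acU.conj, acV.conj, ?_, ?_⟩, ?_, ?_⟩
  · filter_upwards [eU] with x hx
    rw [hx, Complex.conj_conj]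
  · filter_upwards [eV] with x hx
    rw [hx, deriv_conj, map_add, map_mul, map_mul, Complex.conj_conj, Complex.conj_ofReal]
  · filter_upwards [dV, eU] with x hx hx'
    rw [maxRow1, deriv_conj, hx, hx']
    simp only [map_add, map_sub, map_mul, Complex.conj_ofReal, Complex.conj_conj]
    ring
  · filter_upwards [e2] with x hx
    have := congrArg conj hx
    simp only [map_add, map_mul, Complex.conj_ofReal, Complex.conj_conj] at this
    rw [row2, deriv_conj, this]

theorem CoeffHyp.exists_isACRep_of_mem_adjoint (h : CoeffHyp p q d b c)
    (y : ((opA0 h)†).domain) :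
    ∃ u v : ℝ → ℂ, IsACRep p b (y : L2Sq) u v ∧
      maxRow1 q c u v (y : L2Sq).snd =ᵐ[halfLine] ((opA0 h)† y).fst ∧
      row2 d b c u (y : L2Sq).snd =ᵐ[halfLine] ((opA0 h)† y).snd := by
  refine h.exists_isACRep_of_inner_eq fun f => ?_
  rw [← opA0_apply]
  exact LinearPMap.adjoint_isFormalAdjoint dense_range_embed y
    ⟨embed f, LinearMap.mem_range_self embed f⟩

theorem CoeffHyp.mem_adjoint_domain_iff (h : CoeffHyp p q d b c) (y : L2Sq) :
    y ∈ ((opA0 h)†).domain ↔ ∃ u v : ℝ → ℂ, IsACRep p b y u v ∧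
      MemLp (maxRow1 q c u v y.snd) 2 halfLine ∧ MemLp (row2 d b c u y.snd) 2 halfLine := by
  constructor
  · intro hy
    obtain ⟨u, v, hr, h1, h2⟩ := h.exists_isACRep_of_mem_adjoint ⟨y, hy⟩
    exact ⟨u, v, hr, (memLp_congr_ae h1).2 (Lp.memLp _), (memLp_congr_ae h2).2 (Lp.memLp _)⟩
  · rintro ⟨u, v, hr, m1, m2⟩
    exact LinearPMap.mem_adjoint_domain_of_exists _ ⟨_, hr.inner_opA0 h m1 m2⟩

/-- Some representatives satisfy the formula, and any others agree with them on `[0, ∞)`. -/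
theorem CoeffHyp.adjoint_ae_eq (h : CoeffHyp p q d b c) (y : ((opA0 h)†).domain) {u v : ℝ → ℂ}
    (hr : IsACRep p b (y : L2Sq) u v) :
    ((opA0 h)† y).fst =ᵐ[halfLine] maxRow1 q c u v (y : L2Sq).snd ∧
      ((opA0 h)† y).snd =ᵐ[halfLine] row2 d b c u (y : L2Sq).snd := by
  obtain ⟨u', v', hr', h1, h2⟩ := h.exists_isACRep_of_mem_adjoint y
  exact ⟨h1.symm.trans (hr'.maxRow1_ae_eq hr), h2.symm.trans (hr'.row2_ae_eq hr)⟩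

end AdjointDomain

/-! ### Uniqueness for linear initial value problems. -/

section Uniqueness

/-- A locally absolutely continuous function whose derivative agrees almost everywhere with a
continuous function is differentiable from the right. -/
theorem ACLoc.hasDerivWithinAt_of_ae_eq {u g : ℝ → ℂ} (hu : ACLoc u)
    (hg : ContinuousOn g (Ici 0)) (hug : deriv u =ᵐ[halfLine] g) {x : ℝ} (hx : 0 ≤ x) :
    HasDerivWithinAt u (g x) (Ici x) x := by
  -- Freezing `g` at `g 0` on the negative axis makes it continuous on `ℝ`, so that `x = 0` needs no
  -- separate treatment.
  have hcont : Continuous fun t => g (max t 0) :=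
    hg.comp_continuous (by fun_prop) fun t => le_max_right t 0
  have hd : HasDerivWithinAt (fun t => (∫ s in (0 : ℝ)..t, g (max s 0)) + u 0) (g x) (Ici x) x := by
    have := (hcont.integral_hasStrictDerivAt 0 x).hasDerivAt.hasDerivWithinAt (s := Ici x)
    rw [max_eq_left hx] at this
    exact this.add_const _
  have hE (t : ℝ) (ht : 0 ≤ t) : u t = (∫ s in (0 : ℝ)..t, g (max s 0)) + u 0 := by
    rw [← sub_eq_iff_eq_add, ← hu.integral_deriv ht]
    refine intervalIntegral.integral_congr_ae ?_
    filter_upwards [(ae_restrict_iff' measurableSet_Ioi).1 hug] with s hs hs'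
    rw [uIoc_of_le ht] at hs'
    rw [hs hs'.1, max_eq_left hs'.1.le]
  exact hd.congr (fun t ht => hE t (hx.trans ht)) (hE x hx)

/-- Uniqueness for the initial value problem of a linear `2 × 2` system with continuous
coefficients. -/
theorem eqOn_zero_of_linear_system {u v a₁₁ a₁₂ a₂₁ a₂₂ : ℝ → ℂ} (hu : ACLoc u) (hv : ACLoc v)
    (h₁₁ : ContinuousOn a₁₁ (Ici 0)) (h₁₂ : ContinuousOn a₁₂ (Ici 0))
    (h₂₁ : ContinuousOn a₂₁ (Ici 0)) (h₂₂ : ContinuousOn a₂₂ (Ici 0))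
    (hu' : deriv u =ᵐ[halfLine] fun x => a₁₁ x * u x + a₁₂ x * v x)
    (hv' : deriv v =ᵐ[halfLine] fun x => a₂₁ x * u x + a₂₂ x * v x)
    (hu0 : u 0 = 0) (hv0 : v 0 = 0) {x : ℝ} (hx : 0 ≤ x) : u x = 0 ∧ v x = 0 := by
  have hsub : Icc 0 x ⊆ Ici 0 := Icc_subset_Ici_self
  have bound {a : ℝ → ℂ} (ha : ContinuousOn a (Ici 0)) : ∃ C, ∀ t ∈ Icc 0 x, ‖a t‖ ≤ C :=
    isCompact_Icc.exists_bound_of_continuousOn (ha.mono hsub)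
  obtain ⟨C₁₁, H₁₁⟩ := bound h₁₁
  obtain ⟨C₁₂, H₁₂⟩ := bound h₁₂
  obtain ⟨C₂₁, H₂₁⟩ := bound h₂₁
  obtain ⟨C₂₂, H₂₂⟩ := bound h₂₂
  have hcu := hu.continuousOn
  have hcv := hv.continuousOn
  have du := fun t ht => hu.hasDerivWithinAt_of_ae_eq
    ((h₁₁.mul hcu).add (h₁₂.mul hcv)) hu' (x := t) ht
  have dv := fun t ht => hv.hasDerivWithinAt_of_ae_eq
    ((h₂₁.mul hcu).add (h₂₂.mul hcv)) hv' (x := t) ht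
  have estimate {a b : ℂ} {C D : ℝ} (t : ℝ) (ha : ‖a‖ ≤ C) (hb : ‖b‖ ≤ D) :
      ‖a * u t + b * v t‖ ≤ (C + D) * ‖(u t, v t)‖ := by
    have e1 : ‖u t‖ ≤ ‖(u t, v t)‖ := norm_fst_le (u t, v t)
    have e2 : ‖v t‖ ≤ ‖(u t, v t)‖ := norm_snd_le (u t, v t)
    calc _ ≤ ‖a‖ * ‖u t‖ + ‖b‖ * ‖v t‖ := by
          simpa only [norm_mul] using norm_add_le (a * u t) (b * v t)
      _ ≤ C * ‖(u t, v t)‖ + D * ‖(u t, v t)‖ := by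
          have hC := (norm_nonneg a).trans ha
          have hD := (norm_nonneg b).trans hb
          gcongr
      _ = _ := by ring
  -- Grönwall with zero data. The norm of `ℂ × ℂ` is the maximum norm, hence `K` is the larger row
  -- sum of the bounds.
  have key := norm_le_gronwallBound_of_norm_deriv_right_le (f := fun t => (u t, v t))
    (f' := fun t => (a₁₁ t * u t + a₁₂ t * v t, a₂₁ t * u t + a₂₂ t * v t)) (δ := 0)
    (K := max (C₁₁ + C₁₂) (C₂₁ + C₂₂)) (ε := 0) (a := 0) (b := x)
    ((hcu.mono hsub).prodMk (hcv.mono hsub))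
    (fun t ht => (du t ht.1).prodMk (dv t ht.1)) (by simp [hu0, hv0])
    (fun t ht => by
      have ht' := Ico_subset_Icc_self ht
      rw [add_zero]
      refine max_le ?_ ?_
      · exact (estimate t (H₁₁ t ht') (H₁₂ t ht')).trans
          (mul_le_mul_of_nonneg_right (le_max_left _ _) (norm_nonneg _))
      · exact (estimate t (H₂₁ t ht') (H₂₂ t ht')).trans
          (mul_le_mul_of_nonneg_right (le_max_right _ _) (norm_nonneg _)))
    x ⟨hx, le_rfl⟩
  rw [gronwallBound_ε0_δ0, norm_le_zero_iff] at key
  exact Prod.mk_eq_zero.1 key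

end Uniqueness

/-! ### The kernel of `𝒜₀* - λ`. -/

section Kernel

variable {p q d : ℝ → ℝ} {b c : ℝ → ℂ}

/-- Together with `IsACRep.smul` and `IsACRep.eqOn`, this makes `y ↦ (u 0, v 0)` linear. -/
theorem IsACRep.add {y z : L2Sq} {u v u' v' : ℝ → ℂ} (hr : IsACRep p b y u v)
    (hr' : IsACRep p b z u' v') : IsACRep p b (y + z) (u + u') (v + v') where
  u_ac := hr.u_ac.add hr'.u_ac
  v_ac := hr.v_ac.add hr'.v_ac
  u_eq := (hr.u_eq.add hr'.u_eq).trans (Lp.coeFn_add y.fst z.fst).symm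
  v_eq := by
    filter_upwards [hr.v_eq, hr'.v_eq, hr.u_ac.ae_differentiableAt, hr'.u_ac.ae_differentiableAt,
      Lp.coeFn_add y.snd z.snd] with x h1 h2 h3 h4 h5
    have e : (y + z).snd x = y.snd x + z.snd x := h5
    rw [Pi.add_apply, h1, h2, e, deriv_add h3 h4]
    ring

theorem IsACRep.smul {y : L2Sq} {u v : ℝ → ℂ} (a : ℂ) (hr : IsACRep p b y u v) :
    IsACRep p b (a • y) (a • u) (a • v) where
  u_ac := hr.u_ac.const_smul a
  v_ac := hr.v_ac.const_smul a
  u_eq := (hr.u_eq.const_smul a).trans (Lp.coeFn_smul a y.fst).symm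
  v_eq := by
    filter_upwards [hr.v_eq, Lp.coeFn_smul a y.snd] with x h1 h2
    have e : (a • y).snd x = a * y.snd x := h2
    rw [Pi.smul_apply, h1, e, deriv_const_smul_field, smul_eq_mul, smul_eq_mul]
    ring

/-- The coefficient `p (lam - d) + |b|²` by which the second row of `𝒜₀* y = lam y` is solved for
`y₂`. -/
noncomputable def schurCoeff (p d : ℝ → ℝ) (b : ℝ → ℂ) (lam : ℂ) : ℝ → ℂ := fun x =>
  (p x : ℂ) * (lam - d x) + b x * conj (b x)

/-- Its imaginary part is `p Im lam`, because `d` and `|b|²` are real. -/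
theorem CoeffHyp.schurCoeff_ne_zero (h : CoeffHyp p q d b c) {lam : ℂ} (hlam : lam.im ≠ 0) {x : ℝ}
    (hx : 0 ≤ x) : schurCoeff p d b lam x ≠ 0 := by
  intro h0
  have := congrArg Complex.im h0
  rw [schurCoeff, Complex.mul_conj] at this
  simp [(h.p_pos x hx).ne', hlam] at this

theorem CoeffHyp.continuousOn_inv_schurCoeff (h : CoeffHyp p q d b c) {lam : ℂ}
    (hlam : lam.im ≠ 0) : ContinuousOn (fun x => (schurCoeff p d b lam x)⁻¹) (Ici 0) :=
  ((h.continuousOn_p.mul (continuousOn_const.sub h.continuousOn_d)).add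
    (h.b_contDiffOn.continuousOn.mul h.continuousOn_conj_b)).inv₀
    fun _ hx => h.schurCoeff_ne_zero hlam hx

/-- A solution of `𝒜₀* y = lam y` whose representatives vanish at `0` is zero. -/
theorem CoeffHyp.eq_zero_of_initial_eq_zero (h : CoeffHyp p q d b c) {lam : ℂ}
    (hlam : lam.im ≠ 0) {y : L2Sq} {u v : ℝ → ℂ} (hr : IsACRep p b y u v)
    (h₁ : maxRow1 q c u v y.snd =ᵐ[halfLine] (lam • y).fst)
    (h₂ : row2 d b c u y.snd =ᵐ[halfLine] (lam • y).snd) (hu0 : u 0 = 0) (hv0 : v 0 = 0) :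
    y = 0 := by
  set D := schurCoeff p d b lam
  have hD := h.continuousOn_inv_schurCoeff hlam
  have hb := h.b_contDiffOn.continuousOn
  have hc := h.c_contDiffOn.continuousOn
  have s1 : ∀ᵐ x ∂halfLine, (lam • y).fst x = lam * y.fst x := Lp.coeFn_smul lam y.fst
  have s2 : ∀ᵐ x ∂halfLine, (lam • y).snd x = lam * y.snd x := Lp.coeFn_smul lam y.snd
  -- Multiply the second row by `p` and replace `p u'` by `v - b̄ y₂`.
  have e2 : ∀ᵐ x ∂halfLine, y.snd x = (D x)⁻¹ * (b x * v x + p x * c x * u x) := by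
    filter_upwards [s2, h₂, hr.v_eq, ae_restrict_mem measurableSet_Ioi] with x hx h2 hv hx0
    rw [eq_inv_mul_iff_mul_eq₀ (h.schurCoeff_ne_zero hlam (le_of_lt hx0)), hv]
    rw [hx, row2] at h2
    simp only [schurCoeff]
    linear_combination -(p x : ℂ) * h2
  -- Substituting `e2` into `u' = (v - b̄ y₂) / p`, and into the first row for `v'`, gives the
  -- closed system for `(u, v)`.
  have eu : deriv u =ᵐ[halfLine] fun x =>
      (-((p x : ℂ)⁻¹ * conj (b x) * (D x)⁻¹ * p x * c x)) * u x +
        ((p x : ℂ)⁻¹ * (1 - conj (b x) * (D x)⁻¹ * b x)) * v x := by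
    filter_upwards [e2, hr.v_eq, ae_restrict_mem measurableSet_Ioi] with x h2 hv hx0
    have hp := h.p_ne_zero (le_of_lt hx0)
    have : deriv u x = (p x : ℂ)⁻¹ * (v x - conj (b x) * y.snd x) := by
      rw [hv]
      field_simp
      ring
    rw [this, h2]
    ring
  have ev : deriv v =ᵐ[halfLine] fun x =>
      ((q x : ℂ) - lam + conj (c x) * (D x)⁻¹ * p x * c x) * u x +
        (conj (c x) * (D x)⁻¹ * b x) * v x := by
    filter_upwards [e2, s1, h₁, hr.u_eq] with x h2 hx h1 hu
    rw [hx, maxRow1, ← hu, h2] at h1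
    linear_combination -h1
  have hzero {x : ℝ} (hx : 0 ≤ x) := eqOn_zero_of_linear_system hr.u_ac hr.v_ac
    ((((h.continuousOn_inv_p.mul h.continuousOn_conj_b).mul hD).mul h.continuousOn_p).mul hc).neg
    (h.continuousOn_inv_p.mul (continuousOn_const.sub ((h.continuousOn_conj_b.mul hD).mul hb)))
    ((h.continuousOn_q.sub continuousOn_const).add
      (((h.continuousOn_conj_c.mul hD).mul h.continuousOn_p).mul hc))
    ((h.continuousOn_conj_c.mul hD).mul hb) eu ev hu0 hv0 hx
  have z1 : y.fst = 0 := by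
    refine Lp.ext ?_
    filter_upwards [hr.u_eq, Lp.coeFn_zero ℂ 2 halfLine, ae_restrict_mem measurableSet_Ioi]
      with x hx hx' hx0
    rw [hx', ← hx, (hzero (le_of_lt hx0)).1, Pi.zero_apply]
  have z2 : y.snd = 0 := by
    refine Lp.ext ?_
    filter_upwards [e2, Lp.coeFn_zero ℂ 2 halfLine, ae_restrict_mem measurableSet_Ioi]
      with x hx hx' hx0
    rw [hx', hx, (hzero (le_of_lt hx0)).1, (hzero (le_of_lt hx0)).2, Pi.zero_apply]
    simp
  exact (WithLp.ofLp_injective 2) (Prod.ext z1 z2)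

theorem CoeffHyp.rank_ker_adjoint_sub_smul_le (h : CoeffHyp p q d b c) {lam : ℂ}
    (hlam : lam.im ≠ 0) :
    Module.rank ℂ
      (LinearMap.ker (((opA0 h)†).toFun - lam • ((opA0 h)†).domain.subtype)) ≤ 2 := by
  -- The choices are arbitrary, but their values at 0 are canonical, since representatives agree on
  -- the closed half-line.
  choose u v hr _ _ using fun y => h.exists_isACRep_of_mem_adjoint y
  let ev : ((opA0 h)†).domain →ₗ[ℂ] ℂ × ℂ :=
    { toFun := fun y => (u y 0, v y 0)
      map_add' := fun y z => by
        have e := (hr (y + z)).eqOn ((hr y).add (hr z))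
        exact Prod.ext (e.1 self_mem_Ici) (e.2 self_mem_Ici)
      map_smul' := fun a y => by
        have e := (hr (a • y)).eqOn ((hr y).smul a)
        exact Prod.ext (e.1 self_mem_Ici) (e.2 self_mem_Ici) }
  have hinj : Function.Injective (ev.comp (Submodule.subtype
      (LinearMap.ker (((opA0 h)†).toFun - lam • ((opA0 h)†).domain.subtype)))) := by
    rw [← LinearMap.ker_eq_bot, Submodule.eq_bot_iff]
    rintro ⟨y, hy⟩ hy0
    have hy0' : (u y 0, v y 0) = (0, 0) := hy0
    have hlamy : (opA0 h)† y = lam • (y : L2Sq) := sub_eq_zero.1 hy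
    obtain ⟨e1, e2⟩ := h.adjoint_ae_eq y (hr y)
    rw [hlamy] at e1 e2
    have := h.eq_zero_of_initial_eq_zero hlam (hr y) e1.symm e2.symm (congrArg Prod.fst hy0')
      (congrArg Prod.snd hy0')
    exact Subtype.ext (Subtype.ext this)
  calc _ ≤ Module.rank ℂ (ℂ × ℂ) := LinearMap.rank_le_of_injective _ hinj
    _ = 2 := by rw [rank_prod', Module.rank_self, one_add_one_eq_two]

end Kernel

end SingularSystem

open SingularSystem in
theorem proposition2p1 {p q d : ℝ → ℝ} {b c : ℝ → ℂ} (h : CoeffHyp p q d b c) :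
    -- `𝒜₀` is (densely defined and) symmetric
    (Dense ((opA0 h).domain : Set L2Sq) ∧ (opA0 h).IsFormalAdjoint (opA0 h)) ∧
    -- the domain of the adjoint
    (∀ y : L2Sq, y ∈ ((opA0 h)†).domain ↔
      ∃ u v : ℝ → ℂ, IsACRep p b y u v ∧
        MemLp (maxRow1 q c u v y.snd) 2 halfLine ∧
        MemLp (row2 d b c u y.snd) 2 halfLine) ∧
    -- the action of the adjoint
    (∀ (y : ((opA0 h)†).domain) (u v : ℝ → ℂ), IsACRep p b (y : L2Sq) u v →
      ((opA0 h)† y).fst =ᵐ[halfLine] maxRow1 q c u v (y : L2Sq).snd ∧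
      ((opA0 h)† y).snd =ᵐ[halfLine] row2 d b c u (y : L2Sq).snd) ∧
    -- the dimension of the kernel of `𝒜₀* - lam` for non-real `lam`
    (∀ lam : ℂ, lam.im ≠ 0 →
      Module.rank ℂ
        (LinearMap.ker (((opA0 h)†).toFun - lam • ((opA0 h)†).domain.subtype)) ≤ 2) :=
  ⟨⟨dense_range_embed, isFormalAdjoint_opA0 h⟩, h.mem_adjoint_domain_iff,
    fun y _ _ hr => h.adjoint_ae_eq y hr, fun _ hlam => h.rank_ker_adjoint_sub_smul_le hlam⟩
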